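/- **Theorem.** Write $\mathbb N=\{1,2,\dots\}$, $\mathbb N_0=\mathbb N\cup\{0\}$, and let $\|\cdot\|_1$, $\|\cdot\|_\infty$ be the $1$-norm and the maximum norm on $\mathbb R^n$. Let $d,\mathbf d,\mathbf L,\mathbf J,M,K,N\in\mathbb N$, $\gamma,L\in\mathbb R$, $c\in[\max\{2,L\},\infty)$, $\mathbf l=(\mathbf l_0,\dots,\mathbf l_{\mathbf L})\in\mathbb N^{\mathbf L+1}$ and $\mathbf N\subseteq\{0,\dots,N\}$ satisfy $0\in\mathbf N$, $\mathbf l_0=d$, $\mathbf l_{\mathbf L}=1$ and $\mathbf d\ge\sum_{i=1}^{\mathbf L}\mathbf l_i(\mathbf l_{i-1}+1)$. *Networks.* For $m,n\in\mathbb N$, $s\in\mathbb N_0$, $\theta\in\mathbb R^{\mathbf d}$ with $\mathbf d\ge s+mn+m$ let $\mathcal A^{\theta,s}_{m,n}\colon\mathbb R^n\to\mathbb R^m$ be the affine map whose $i$-th component is $x\mapsto\sum_{j=1}^n\theta_{s+(i-1)n+j}\,x_j+\theta_{s+mn+i}$. For $1\le i<\mathbf L$ let $\mathbf a_i\colon\mathbb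 R^{\mathbf l_i}\to\mathbb R^{\mathbf l_i}$ be the componentwise map $x\mapsto\max\{x,0\}$, let $\mathbf a_{\mathbf L}(x)=\max\{\min\{x,1\},0\}$ for $x\in\mathbb R$, and for $\theta\in\mathbb R^{\mathbf d}$ let $\mathscr N_\theta\colon\mathbb R^d\to\mathbb R$ be $$\mathscr N_\theta=\mathbf a_{\mathbf L}\circ\mathcal A^{\theta,s_{\mathbf L}}_{\mathbf l_{\mathbf L},\mathbf l_{\mathbf L-1}}\circ\mathbf a_{\mathbf L-1}\circ\mathcal A^{\theta,s_{\mathbf L-1}}_{\mathbf l_{\mathbf L-1},\mathbf l_{\mathbf L-2}}\circ\dots\circ\mathbf a_1\circ\mathcal A^{\theta,s_1}_{\mathbf l_1,\mathbf l_0},\qquad s_r=\sum_{i=1}^{r-1}\mathbf l_i(\mathbf l_{i-1}+1).$$ *Data.* Let $(\Omega,\mathcal F,\mathbb P)$ be a probability space, and let $X^{k,n}_j\colon\Omega\to[0,1]^d$ and $Y^{k,n}_j\colon\Omega\to[0,1]$, $k,n,j\in\mathbb N_0$, be functions such that $(X^{0,0}_j,Y^{0,0}_j)$, $j\in\mathbb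 N$, are i.i.d. random variables. Let $\mathcal E\colon[0,1]^d\to[0,1]$ satisfy $\mathcal E(X^{0,0}_1)=\mathbb E[Y^{0,0}_1\mid X^{0,0}_1]$ $\mathbb P$-a.s. and $|\mathcal E(x)-\mathcal E(y)|\le L\|x-y\|_1$ for all $x,y\in[0,1]^d$. For $k,n\in\mathbb N_0$, $J\in\mathbb N$, $\theta\in\mathbb R^{\mathbf d}$, $\omega\in\Omega$ let $$\mathcal R^{k,n}_J(\theta,\omega)=\frac1J\sum_{j=1}^J\bigl|\mathscr N_\theta(X^{k,n}_j(\omega))-Y^{k,n}_j(\omega)\bigr|^2.$$ *Training.* Let $\Theta_{k,n}\colon\Omega\to\mathbb R^{\mathbf d}$, $k,n\in\mathbb N_0$, and $\mathbf k\colon\Omega\to(\mathbb N_0)^2$ be random variables. Assume that $\Theta_{k,0}$, $k\in\mathbb N$, are i.i.d. with values in $[-c,c]^{\mathbf d}$ and that $\Theta_{1,0}$ is uniformly distributed on $[-c,c]^{\mathbf d}$. Let $\mathcal G^{k,n}\colon\mathbb R^{\mathbf d}\times\Omega\to\mathbb R^{\mathbf d}$, $k,n\in\mathbb N$, be functions such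 that $\mathcal G^{k,n}(\theta,\omega)=(\nabla_\theta\mathcal R^{k,n}_{\mathbf J})(\theta,\omega)$ for all $k,n\in\mathbb N$, $\omega\in\Omega$ and all $\theta$ at which $\mathcal R^{k,n}_{\mathbf J}(\cdot,\omega)$ is differentiable. Assume for all $k,n\in\mathbb N$, $\omega\in\Omega$ that $$\Theta_{k,n}(\omega)=\Theta_{k,n-1}(\omega)-\gamma\,\mathcal G^{k,n}(\Theta_{k,n-1}(\omega),\omega)$$ and for all $\omega\in\Omega$ that $$\mathbf k(\omega)\in\operatorname*{arg\,min}_{(l,m)\in\{1,\dots,K\}\times\mathbf N,\ \|\Theta_{l,m}(\omega)\|_\infty\le c}\mathcal R^{0,0}_M(\Theta_{l,m}(\omega),\omega).$$ Then $\Omega\times[0,1]^d\ni(\omega,x)\mapsto|\mathscr N_{\Theta_{\mathbf k(\omega)}(\omega)}(x)-\mathcal E(x)|$ is measurable and $$\mathbb E\Bigl[\int_{[0,1]^d}\bigl|\mathscr N_{\Theta_{\mathbf k}}(x)-\mathcal E(x)\bigr|\,\mathbb P_{X^{0,0}_1}(\mathrm dx)\Bigr]\le\frac{d\,c^3}{[\min\{\mathbf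 L,\mathbf l_1,\dots,\mathbf l_{\mathbf L-1}\}]^{1/d}}+\frac{c^3\,\mathbf L(\|\mathbf l\|_\infty+1)\ln(eM)}{M^{1/4}}+\frac{\mathbf L(\|\mathbf l\|_\infty+1)^{\mathbf L}c^{\mathbf L+1}}{K^{[(2\mathbf L)^{-1}(\|\mathbf l\|_\infty+1)^{-2}]}}.$$ -/

import Mathlib

open MeasureTheory ProbabilityTheory

noncomputable section

/-- The cube `[0,1]^d`. -/
abbrev UnitCube (d : ℕ) : Type := Set.Icc (0 : Fin d → ℝ) 1

/-- The `i`-th entry (counted from `0`) of the parameter vector `θ ∈ ℝ^D`. The value `0` beyond the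
length of `θ` is never used by a network whose number of parameters is at most `D`. -/
def param {D : ℕ} (θ : Fin D → ℝ) (i : ℕ) : ℝ := if h : i < D then θ ⟨i, h⟩ else 0

/-- The affine map `ℝ^n → ℝ^m` whose `m × n` weight matrix, row by row, and then bias vector are
the entries of `θ` that follow the first `s` ones. -/
def affineMap {D : ℕ} (θ : Fin D → ℝ) (s m n : ℕ) (x : Fin n → ℝ) : Fin m → ℝ :=
  fun i => (∑ j : Fin n, param θ (s + (i : ℕ) * n + (j : ℕ)) * x j)
    + param θ (s + m * n + (i : ℕ))

/-- Number of parameters of the first `i` affine maps: `∑_{j=1}^{i} l_j (l_{j-1} + 1)`. -/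
def numParams (l : ℕ → ℕ) (i : ℕ) : ℕ := ∑ j ∈ Finset.Icc 1 i, l j * (l (j - 1) + 1)

/-- The values in the `i`-th layer of a fully connected network with layer dimensions
`l 0, l 1, …`, where every layer is followed by the componentwise rectifier `max{·, 0}`. -/
def hiddenLayer {D : ℕ} (θ : Fin D → ℝ) (l : ℕ → ℕ) :
    (i : ℕ) → (Fin (l 0) → ℝ) → (Fin (l i) → ℝ)
  | 0, x => x
  | i + 1, x => fun r =>
      max (affineMap θ (numParams l i) (l (i + 1)) (l i) (hiddenLayer θ l i x) r) 0

/-- The clipping function `x ↦ max{min{x, 1}, 0}`. -/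
def clip (x : ℝ) : ℝ := max (min x 1) 0

/-- The realisation `ℝ^d → ℝ` of the network with parameter vector `θ`, layer dimensions
`l 0 = d, l 1, …, l (L - 1), 1`, rectifier activation on the hidden layers `1, …, L - 1` and
clipping on the one-dimensional output layer. -/
def clippedNN {D d : ℕ} (L : ℕ) (l : ℕ → ℕ) (h0 : l 0 = d) (θ : Fin D → ℝ) (x : Fin d → ℝ) : ℝ :=
  clip (affineMap θ (numParams l (L - 1)) 1 (l (L - 1))
    (hiddenLayer θ l (L - 1) (fun j => x (Fin.cast h0 j))) 0)

/-- The empirical risk `(1/J) ∑_{j=1}^{J} |N_θ(x_j) - y_j|²`. -/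
def empiricalRisk {D d : ℕ} (L : ℕ) (l : ℕ → ℕ) (h0 : l 0 = d)
    (x : ℕ → UnitCube d) (y : ℕ → unitInterval) (J : ℕ) (θ : Fin D → ℝ) : ℝ :=
  (1 / (J : ℝ)) * ∑ j ∈ Finset.Icc 1 J, |clippedNN L l h0 θ (x j : Fin d → ℝ) - (y j : ℝ)| ^ 2

/-- The gradient, as the vector of partial derivatives (used at points of differentiability). -/
def grad {D : ℕ} (f : (Fin D → ℝ) → ℝ) (θ : Fin D → ℝ) : Fin D → ℝ :=
  fun i => fderiv ℝ f θ (Pi.single i 1)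

/-- `‖l‖_∞ = max{l_0, …, l_L}`. -/
def maxWidth (L : ℕ) (l : ℕ → ℕ) : ℕ := (Finset.range (L + 1)).sup l

/-- `min{L, l_1, …, l_{L-1}}`. -/
def minSize (L : ℕ) (l : ℕ → ℕ) : ℕ :=
  (insert L ((Finset.Ico 1 L).image l)).min' (Finset.insert_nonempty _ _)

end

/-
If the first or the second summand of the bound is at least `1` there is nothing to prove, since the
error is at most `1`. Otherwise the claim splits into three estimates.

Approximation: a `c`-Lipschitz function equals, up to `2 c δ`, the maximum of the cones
`E q - c ‖x - q‖₁` over a `δ`-net of points `q`. A network with one hidden layer per point can carry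
this maximum along as a running maximum, which yields a parameter `θ₀` in the box `[-c, c]^p`.

Generalisation: on the box the network is Lipschitz in its parameter, so the uniform deviation of
the empirical risk is controlled by the deviations on a finite grid, and the expected maximum of
finitely many sub-Gaussian averages grows only logarithmically in their number.

Optimisation: the best of `K` independent uniform initialisations has expected distance at most
`2 c K^(-1/p)` from `θ₀`. Gradient descent can only help, because the initialisations are themselves
candidates in the selection of `kk`.

For empirical risk minimisers these combine through the bias-variance decomposition
`𝔼|f(X) - Y|² = 𝔼|f(X) - E(X)|² + 𝔼|E(X) - Y|²`.
-/

section Basic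

lemma numParams_succ (l : ℕ → ℕ) (i : ℕ) :
    numParams l (i + 1) = numParams l i + l (i + 1) * (l i + 1) := by
  simp [numParams, Finset.sum_Icc_succ_top]

lemma numParams_mono (l : ℕ → ℕ) : Monotone (numParams l) :=
  monotone_nat_of_le_succ fun i => by rw [numParams_succ]; exact Nat.le_add_right _ _

lemma weight_index_lt {m n i j : ℕ} (hi : i < m) (hj : j < n) : i * n + j < m * (n + 1) := by
  nlinarith

lemma bias_index_lt {m n i : ℕ} (hi : i < m) : m * n + i < m * (n + 1) := by
  nlinarith

lemma le_maxWidth {L : ℕ} (l : ℕ → ℕ) {i : ℕ} (hi : i ≤ L) : l i ≤ maxWidth L l :=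
  Finset.le_sup (Finset.mem_range.2 (Nat.lt_succ_of_le hi))

lemma numParams_le (L : ℕ) (l : ℕ → ℕ) : numParams l L ≤ L * (maxWidth L l + 1) ^ 2 := by
  calc numParams l L ≤ ∑ _j ∈ Finset.Icc 1 L, (maxWidth L l + 1) ^ 2 := by
        refine Finset.sum_le_sum fun j hj => ?_
        rw [Finset.mem_Icc] at hj
        have h1 := le_maxWidth l hj.2
        have h2 := le_maxWidth l (show j - 1 ≤ L by omega)
        calc l j * (l (j - 1) + 1) ≤ (maxWidth L l + 1) * (maxWidth L l + 1) := by gcongr; omega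
          _ = _ := (sq _).symm
    _ = _ := by simp

lemma numParams_ne_zero {L : ℕ} (hL : 1 ≤ L) {l : ℕ → ℕ} (hlL : l L = 1) : numParams l L ≠ 0 := by
  obtain ⟨i, rfl⟩ := Nat.exists_eq_add_of_le' hL
  rw [numParams_succ, hlL]
  omega

lemma minSize_le_depth (L : ℕ) (l : ℕ → ℕ) : minSize L l ≤ L :=
  Finset.min'_le _ _ (Finset.mem_insert_self _ _)

lemma minSize_le_width {L : ℕ} (l : ℕ → ℕ) {i : ℕ} (h1 : 1 ≤ i) (hi : i < L) :
    minSize L l ≤ l i :=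
  Finset.min'_le _ _ (Finset.mem_insert_of_mem
    (Finset.mem_image_of_mem _ (Finset.mem_Ico.2 ⟨h1, hi⟩)))

lemma minSize_pos {L : ℕ} (hL : 1 ≤ L) {l : ℕ → ℕ} (hl : ∀ i ≤ L, 1 ≤ l i) : 0 < minSize L l := by
  have h := Finset.min'_mem (insert L ((Finset.Ico 1 L).image l)) (Finset.insert_nonempty _ _)
  rw [Finset.mem_insert, Finset.mem_image] at h
  rcases h with h | ⟨i, hi, h⟩
  · exact hL.trans h.ge
  · exact (hl i (Finset.mem_Ico.1 hi).2.le).trans h.le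

lemma clip_mem_Icc (x : ℝ) : clip x ∈ Set.Icc (0 : ℝ) 1 :=
  ⟨le_max_right _ _, max_le (min_le_right _ _) zero_le_one⟩

lemma clip_of_mem_Icc {x : ℝ} (hx : x ∈ Set.Icc (0 : ℝ) 1) : clip x = x := by
  rw [clip, min_eq_left hx.2, max_eq_left hx.1]

lemma abs_clip_sub_clip_le (x y : ℝ) : |clip x - clip y| ≤ |x - y| := by
  have h1 := abs_max_sub_max_le_max (min x 1) 0 (min y 1) 0
  have h2 := abs_min_sub_min_le_max x 1 y 1
  simp only [sub_self, abs_zero, abs_nonneg, sup_of_le_left] at h1 h2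
  exact h1.trans h2

lemma clippedNN_mem_Icc {D d L : ℕ} {l : ℕ → ℕ} (h0 : l 0 = d) (θ : Fin D → ℝ) (x : Fin d → ℝ) :
    clippedNN L l h0 θ x ∈ Set.Icc (0 : ℝ) 1 :=
  clip_mem_Icc _

lemma abs_sub_le_one_of_mem_Icc {a b : ℝ} (ha : a ∈ Set.Icc (0 : ℝ) 1)
    (hb : b ∈ Set.Icc (0 : ℝ) 1) : |a - b| ≤ 1 := by
  simpa using abs_sub_le_of_le_of_le ha.1 ha.2 hb.1 hb.2

lemma norm_le_one_of_unitCube {d : ℕ} (x : UnitCube d) : ‖(x : Fin d → ℝ)‖ ≤ 1 :=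
  (pi_norm_le_iff_of_nonneg zero_le_one).2 fun j => by
    rw [Real.norm_of_nonneg (x.2.1 j)]; exact x.2.2 j

end Basic

section Parameters

variable {D : ℕ}

lemma abs_param_le_norm (θ : Fin D → ℝ) (k : ℕ) : |param θ k| ≤ ‖θ‖ := by
  unfold param
  split_ifs with h
  · exact norm_le_pi_norm θ ⟨k, h⟩
  · simp

lemma continuous_param (k : ℕ) : Continuous fun θ : Fin D → ℝ => param θ k := by
  unfold param
  split_ifs <;> fun_prop

/-- The first `p` entries of a parameter vector, continued by `0`. A network only reads its
`numParams l L` leading parameters. -/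
def leadingParams (p : ℕ) (θ : Fin D → ℝ) : Fin p → ℝ := fun i => param θ i

lemma norm_leadingParams_le (p : ℕ) (θ : Fin D → ℝ) : ‖leadingParams p θ‖ ≤ ‖θ‖ :=
  (pi_norm_le_iff_of_nonneg (norm_nonneg _)).2 fun i => abs_param_le_norm θ i

lemma continuous_leadingParams (p : ℕ) :
    Continuous (leadingParams p : (Fin D → ℝ) → Fin p → ℝ) :=
  continuous_pi fun i => continuous_param i

lemma continuous_hiddenLayer (l : ℕ → ℕ) (i : ℕ) :
    Continuous fun z : (Fin D → ℝ) × (Fin (l 0) → ℝ) => hiddenLayer z.1 l i z.2 := by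
  induction i with
  | zero => exact continuous_snd
  | succ i ih =>
    refine continuous_pi fun r => Continuous.max ?_ continuous_const
    exact (continuous_finsetSum _ fun j _ => ((continuous_param _).comp continuous_fst).mul
      ((continuous_apply j).comp ih)).add ((continuous_param _).comp continuous_fst)

lemma continuous_clippedNN {d : ℕ} (L : ℕ) (l : ℕ → ℕ) (h0 : l 0 = d) :
    Continuous fun z : (Fin D → ℝ) × (Fin d → ℝ) => clippedNN L l h0 z.1 z.2 := by
  have h : Continuous fun z : (Fin D → ℝ) × (Fin d → ℝ) =>
      hiddenLayer z.1 l (L - 1) (fun j => z.2 (Fin.cast h0 j)) :=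
    (continuous_hiddenLayer l (L - 1)).comp (continuous_fst.prodMk
      (continuous_pi fun j => (continuous_apply _).comp continuous_snd))
  refine Continuous.max (Continuous.min ?_ continuous_const) continuous_const
  exact (continuous_finsetSum _ fun j _ => ((continuous_param _).comp continuous_fst).mul
    ((continuous_apply j).comp h)).add ((continuous_param _).comp continuous_fst)

end Parameters

section Lipschitz

variable {D D' : ℕ} {s m n : ℕ} {c B Δ : ℝ}

lemma norm_affineMap_le {θ : Fin D → ℝ} (hθ : ‖θ‖ ≤ c) (hB : 1 ≤ B) {x : Fin n → ℝ}
    (hx : ‖x‖ ≤ B) : ‖affineMap θ s m n x‖ ≤ c * (n + 1) * B := by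
  have hc : 0 ≤ c := (norm_nonneg θ).trans hθ
  have hparam : ∀ k, |param θ k| ≤ c := fun k => (abs_param_le_norm θ k).trans hθ
  refine (pi_norm_le_iff_of_nonneg (by positivity)).2 fun i => ?_
  have hsum : |∑ j : Fin n, param θ (s + (i : ℕ) * n + (j : ℕ)) * x j| ≤ n * (c * B) := by
    refine (Finset.abs_sum_le_sum_abs _ _).trans
      ((Finset.sum_le_card_nsmul _ _ (c * B) fun j _ => ?_).trans (by simp))
    rw [abs_mul]
    exact mul_le_mul (hparam _) ((norm_le_pi_norm x j).trans hx) (abs_nonneg _) hc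
  calc |affineMap θ s m n x i| ≤ n * (c * B) + c := (abs_add_le _ _).trans
        (add_le_add hsum (hparam _))
    _ ≤ c * (n + 1) * B := by nlinarith

lemma norm_affineMap_sub_affineMap_le (θ : Fin D → ℝ) (x y : Fin n → ℝ) :
    ‖affineMap θ s m n x - affineMap θ s m n y‖ ≤ ‖θ‖ * n * ‖x - y‖ := by
  refine (pi_norm_le_iff_of_nonneg (by positivity)).2 fun i => ?_
  have hdiff : (affineMap θ s m n x - affineMap θ s m n y) i
      = ∑ j : Fin n, param θ (s + (i : ℕ) * n + (j : ℕ)) * (x - y) j := by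
    simp only [affineMap, Pi.sub_apply, mul_sub, Finset.sum_sub_distrib]; ring
  rw [hdiff, Real.norm_eq_abs]
  refine (Finset.abs_sum_le_sum_abs _ _).trans
    ((Finset.sum_le_card_nsmul _ _ (‖θ‖ * ‖x - y‖) fun j _ => ?_).trans_eq (by simp; ring))
  rw [abs_mul]
  exact mul_le_mul (abs_param_le_norm θ _) (norm_le_pi_norm (x - y) j) (abs_nonneg _)
    (norm_nonneg _)

lemma norm_affineMap_sub_params_le {θ : Fin D → ℝ} {θ' : Fin D' → ℝ} (hΔ : 0 ≤ Δ)
    (hθθ' : ∀ k < m * (n + 1), |param θ (s + k) - param θ' (s + k)| ≤ Δ) (hB : 1 ≤ B)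
    {x : Fin n → ℝ} (hx : ‖x‖ ≤ B) :
    ‖affineMap θ s m n x - affineMap θ' s m n x‖ ≤ (n + 1) * B * Δ := by
  refine (pi_norm_le_iff_of_nonneg (by positivity)).2 fun i => ?_
  have hdiff : (affineMap θ s m n x - affineMap θ' s m n x) i
      = (∑ j : Fin n, (param θ (s + ((i : ℕ) * n + j)) - param θ' (s + ((i : ℕ) * n + j))) * x j)
        + (param θ (s + (m * n + i)) - param θ' (s + (m * n + i))) := by
    simp only [affineMap, Pi.sub_apply, sub_mul, Finset.sum_sub_distrib, add_assoc]; ring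
  have hsum : |∑ j : Fin n,
      (param θ (s + ((i : ℕ) * n + j)) - param θ' (s + ((i : ℕ) * n + j))) * x j|
        ≤ n * (Δ * B) := by
    refine (Finset.abs_sum_le_sum_abs _ _).trans
      ((Finset.sum_le_card_nsmul _ _ (Δ * B) fun j _ => ?_).trans (by simp))
    rw [abs_mul]
    exact mul_le_mul (hθθ' _ (weight_index_lt i.2 j.2)) ((norm_le_pi_norm x j).trans hx)
      (abs_nonneg _) hΔ
  rw [hdiff, Real.norm_eq_abs]
  calc _ ≤ n * (Δ * B) + Δ := (abs_add_le _ _).trans (add_le_add hsum (hθθ' _ (bias_index_lt i.2)))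
    _ ≤ (n + 1) * B * Δ := by nlinarith

lemma norm_affineMap_sub_le {θ : Fin D → ℝ} {θ' : Fin D' → ℝ} (hθ' : ‖θ'‖ ≤ c) (hΔ : 0 ≤ Δ)
    (hθθ' : ∀ k < m * (n + 1), |param θ (s + k) - param θ' (s + k)| ≤ Δ) (hB : 1 ≤ B)
    {x y : Fin n → ℝ} (hx : ‖x‖ ≤ B) :
    ‖affineMap θ s m n x - affineMap θ' s m n y‖ ≤ c * (n + 1) * ‖x - y‖ + (n + 1) * B * Δ := by
  have hc : 0 ≤ c := (norm_nonneg θ').trans hθ'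
  calc ‖affineMap θ s m n x - affineMap θ' s m n y‖
      ≤ ‖affineMap θ s m n x - affineMap θ' s m n x‖
        + ‖affineMap θ' s m n x - affineMap θ' s m n y‖ := norm_sub_le_norm_sub_add_norm_sub _ _ _
    _ ≤ (n + 1) * B * Δ + ‖θ'‖ * n * ‖x - y‖ :=
        add_le_add (norm_affineMap_sub_params_le hΔ hθθ' hB hx)
          (norm_affineMap_sub_affineMap_le θ' x y)
    _ ≤ (n + 1) * B * Δ + c * (n + 1) * ‖x - y‖ := by gcongr; linarith
    _ = _ := add_comm _ _

lemma norm_relu_sub_relu_le {ι : Type*} [Fintype ι] (u v : ι → ℝ) :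
    ‖(fun r => max (u r) 0) - fun r => max (v r) 0‖ ≤ ‖u - v‖ :=
  (pi_norm_le_iff_of_nonneg (norm_nonneg _)).2 fun r =>
    (by simpa using abs_max_sub_max_le_max (u r) 0 (v r) 0 :
      |max (u r) 0 - max (v r) 0| ≤ |u r - v r|).trans (norm_le_pi_norm (u - v) r)

lemma norm_relu_le {ι : Type*} [Fintype ι] (u : ι → ℝ) : ‖fun r => max (u r) 0‖ ≤ ‖u‖ := by
  simpa only [Pi.zero_apply, max_self, ← Pi.zero_def, sub_zero] using norm_relu_sub_relu_le u 0

variable {l : ℕ → ℕ} {W : ℝ} {x : Fin (l 0) → ℝ}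

lemma norm_hiddenLayer_le {θ : Fin D → ℝ} (hc : 1 ≤ c) (hθ : ‖θ‖ ≤ c) (i : ℕ)
    (hW : ∀ j < i, (l j : ℝ) ≤ W) (hx : ‖x‖ ≤ 1) :
    ‖hiddenLayer θ l i x‖ ≤ (c * (W + 1)) ^ i := by
  induction i with
  | zero => simpa [hiddenLayer] using hx
  | succ i ih =>
    have hlW := hW i i.lt_succ_self
    have hW0 : 0 ≤ W := (Nat.cast_nonneg _).trans hlW
    have h1 : 1 ≤ c * (W + 1) := by nlinarith
    calc ‖hiddenLayer θ l (i + 1) x‖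
        ≤ ‖affineMap θ (numParams l i) (l (i + 1)) (l i) (hiddenLayer θ l i x)‖ :=
          norm_relu_le _
      _ ≤ c * (l i + 1) * (c * (W + 1)) ^ i :=
          norm_affineMap_le hθ (one_le_pow₀ h1) (ih fun j hj => hW j (hj.trans i.lt_succ_self))
      _ ≤ c * (W + 1) * (c * (W + 1)) ^ i := by gcongr
      _ = (c * (W + 1)) ^ (i + 1) := (pow_succ' _ _).symm

lemma norm_affineMap_hiddenLayer_sub_le {θ : Fin D → ℝ} {θ' : Fin D' → ℝ} (hc : 1 ≤ c)
    (hΔ : 0 ≤ Δ) (hθ : ‖θ‖ ≤ c) (hθ' : ‖θ'‖ ≤ c) (hx : ‖x‖ ≤ 1) (i : ℕ)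
    (hW : ∀ j ≤ i, (l j : ℝ) ≤ W)
    (hθθ' : ∀ k < numParams l (i + 1), |param θ k - param θ' k| ≤ Δ) :
    ‖affineMap θ (numParams l i) (l (i + 1)) (l i) (hiddenLayer θ l i x)
      - affineMap θ' (numParams l i) (l (i + 1)) (l i) (hiddenLayer θ' l i x)‖
        ≤ (i + 1) * (W + 1) ^ (i + 1) * c ^ i * Δ := by
  have hlW := hW i le_rfl
  have hW0 : 0 ≤ W := (Nat.cast_nonneg _).trans hlW
  have h1 : 1 ≤ c * (W + 1) := by nlinarith
  have hlayer := norm_affineMap_sub_le (s := numParams l i) (m := l (i + 1)) (θ := θ)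
    (y := hiddenLayer θ' l i x) hθ' hΔ
    (fun k hk => hθθ' _ (by rw [numParams_succ]; omega)) (one_le_pow₀ h1)
    (norm_hiddenLayer_le hc hθ i (fun j hj => hW j hj.le) hx)
  have hprev : ‖hiddenLayer θ l i x - hiddenLayer θ' l i x‖
      ≤ i * (W + 1) ^ i * c ^ (i - 1) * Δ := by
    cases i with
    | zero => simp [hiddenLayer]
    | succ i =>
      have ih := norm_affineMap_hiddenLayer_sub_le hc hΔ hθ hθ' hx i
        (fun j hj => hW j (hj.trans i.le_succ))
        (fun k hk => hθθ' k (hk.trans_le (numParams_mono l (i + 1).le_succ)))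
      simpa using! (norm_relu_sub_relu_le _ _).trans ih
  calc _ ≤ c * (l i + 1) * (i * (W + 1) ^ i * c ^ (i - 1) * Δ)
        + (l i + 1) * (c * (W + 1)) ^ i * Δ := hlayer.trans (by gcongr)
    _ ≤ c * (W + 1) * (i * (W + 1) ^ i * c ^ (i - 1) * Δ)
        + (W + 1) * (c * (W + 1)) ^ i * Δ := by gcongr
    _ = (i + 1) * (W + 1) ^ (i + 1) * c ^ i * Δ := by
      rcases i with _ | i
      · simp
      · simp only [Nat.add_sub_cancel, mul_pow]; push_cast; ring

/-- A Lipschitz constant, with respect to the maximum norm on the parameters in `[-c, c]`, of a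
clipped network with depth `L` and layer dimensions `l` on the unit cube. -/
def netLipschitz (L : ℕ) (l : ℕ → ℕ) (c : ℝ) : ℝ :=
  L * ((maxWidth L l : ℝ) + 1) ^ L * c ^ (L - 1)

lemma netLipschitz_nonneg (L : ℕ) (l : ℕ → ℕ) (hc : 0 ≤ c) : 0 ≤ netLipschitz L l c := by
  unfold netLipschitz; positivity

theorem abs_clippedNN_sub_le {d L : ℕ} (hL : 1 ≤ L) (hl0 : l 0 = d) (hlL : l L = 1)
    (hc : 1 ≤ c) {θ : Fin D → ℝ} {θ' : Fin (numParams l L) → ℝ} (hθ : ‖θ‖ ≤ c) (hθ' : ‖θ'‖ ≤ c)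
    {x : Fin d → ℝ} (hx : ‖x‖ ≤ 1) :
    |clippedNN L l hl0 θ x - clippedNN L l hl0 θ' x|
      ≤ netLipschitz L l c * ‖leadingParams (numParams l L) θ - θ'‖ := by
  subst hl0
  obtain ⟨i, rfl⟩ : ∃ i, L = i + 1 := ⟨L - 1, by omega⟩
  have hparam : ∀ k < numParams l (i + 1),
      |param θ k - param θ' k| ≤ ‖leadingParams (numParams l (i + 1)) θ - θ'‖ := by
    intro k hk
    have h := norm_le_pi_norm (leadingParams (numParams l (i + 1)) θ - θ') ⟨k, hk⟩
    rwa [Pi.sub_apply, leadingParams, Real.norm_eq_abs,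
      show θ' ⟨k, hk⟩ = param θ' k by rw [param, dif_pos hk]] at h
  have h := norm_affineMap_hiddenLayer_sub_le (W := maxWidth (i + 1) l) hc (norm_nonneg _) hθ hθ'
    hx i (fun j hj => by exact_mod_cast le_maxWidth l (hj.trans i.le_succ)) hparam
  rw [hlL] at h
  refine (abs_clip_sub_clip_le _ _).trans ((norm_le_pi_norm _ (0 : Fin 1)).trans (h.trans_eq ?_))
  simp [netLipschitz]

end Lipschitz

section PrescribedParameters

/-- The parameters of the affine map with weight matrix `wt` and bias vector `b`, in the order in
which `affineMap` reads them. -/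
noncomputable def layerBlock (m n : ℕ) (wt : ℕ → ℕ → ℝ) (b : ℕ → ℝ) (k : ℕ) : ℝ :=
  if k < m * n then wt (k / n) (k % n) else b (k - m * n)

lemma affineMap_of_layerBlock {D m n s : ℕ} {θ : Fin D → ℝ} {wt : ℕ → ℕ → ℝ} {b : ℕ → ℝ}
    (h : ∀ k < m * (n + 1), param θ (s + k) = layerBlock m n wt b k) (x : Fin n → ℝ) (r : Fin m) :
    affineMap θ s m n x r = (∑ j : Fin n, wt r j * x j) + b r := by
  have hweight : ∀ j : Fin n, param θ (s + r * n + j) = wt r j := by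
    intro j
    have hlt : (r : ℕ) * n + j < m * n := by nlinarith [r.2, j.2]
    have hn : 0 < n := j.pos
    rw [add_assoc, h _ (weight_index_lt r.2 j.2), layerBlock, if_pos hlt, mul_comm,
      Nat.mul_add_div hn, Nat.div_eq_of_lt j.2, add_zero, Nat.mul_add_mod, Nat.mod_eq_of_lt j.2]
  have hbias : param θ (s + m * n + r) = b r := by
    rw [add_assoc, h _ (bias_index_lt r.2), layerBlock, if_neg (by omega), Nat.add_sub_cancel_left]
  simp only [affineMap, hweight, hbias]

lemma exists_concat {α : Type*} {N : ℕ → ℕ} (hN : Monotone N) (B : ℕ → ℕ → α) (n : ℕ) :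
    ∃ g : ℕ → α, (∀ k, ∃ i j, g k = B i j) ∧
      ∀ i < n, ∀ k, N i + k < N (i + 1) → g (N i + k) = B i k := by
  induction n with
  | zero => exact ⟨B 0, fun k => ⟨0, k, rfl⟩, by simp⟩
  | succ n ih =>
    obtain ⟨g, hg, hgi⟩ := ih
    refine ⟨fun k => if k < N n then g k else B n (k - N n), fun k => ?_, fun i hi k hk => ?_⟩
    · dsimp only
      split_ifs
      exacts [hg k, ⟨n, _, rfl⟩]
    · rcases Nat.lt_succ_iff_lt_or_eq.mp hi with hi | rfl
      · dsimp only
        rw [if_pos (hk.trans_le (hN hi)), hgi i hi k hk]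
      · simp

lemma exists_params_affineMap_eq {l : ℕ → ℕ} {n : ℕ} {wt : ℕ → ℕ → ℕ → ℝ} {b : ℕ → ℕ → ℝ} {c : ℝ}
    (hc : 0 ≤ c) (hwt : ∀ i r j, |wt i r j| ≤ c) (hb : ∀ i r, |b i r| ≤ c) :
    ∃ θ : Fin (numParams l n) → ℝ, ‖θ‖ ≤ c ∧ ∀ i < n, ∀ (r : Fin (l (i + 1))) (x : Fin (l i) → ℝ),
      affineMap θ (numParams l i) (l (i + 1)) (l i) x r
        = (∑ j : Fin (l i), wt i r j * x j) + b i r := by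
  obtain ⟨g, hg, hgi⟩ := exists_concat (numParams_mono l)
    (fun i => layerBlock (l (i + 1)) (l i) (wt i) (b i)) n
  refine ⟨fun k => g k, (pi_norm_le_iff_of_nonneg hc).2 fun k => ?_, fun i hi r x =>
    affineMap_of_layerBlock (fun k hk => ?_) x r⟩
  · obtain ⟨i, j, h⟩ := hg k
    rw [h, layerBlock]
    split_ifs
    exacts [hwt _ _ _, hb _ _]
  · have hlt : numParams l i + k < numParams l (i + 1) := by rw [numParams_succ]; omega
    rw [param, dif_pos (hlt.trans_le (numParams_mono l hi)), hgi i hi k hlt]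

end PrescribedParameters

section RunningMax

/-- `max {0, s 0, …, s (n - 1)}`. -/
noncomputable def runningMax (s : ℕ → ℝ) (n : ℕ) : ℝ := (Finset.range n).fold max 0 s

lemma runningMax_zero (s : ℕ → ℝ) : runningMax s 0 = 0 := rfl

lemma runningMax_succ (s : ℕ → ℝ) (n : ℕ) :
    runningMax s (n + 1) = max (s n) (runningMax s n) := by
  rw [runningMax, Finset.range_add_one, Finset.fold_insert Finset.notMem_range_self, runningMax]

lemma runningMax_nonneg (s : ℕ → ℝ) (n : ℕ) : 0 ≤ runningMax s n :=
  Finset.le_fold_max _ |>.2 (.inl le_rfl)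

lemma le_runningMax (s : ℕ → ℝ) {i n : ℕ} (hi : i < n) : s i ≤ runningMax s n :=
  Finset.le_fold_max _ |>.2 (.inr ⟨i, Finset.mem_range.2 hi, le_rfl⟩)

lemma runningMax_le {s : ℕ → ℝ} {B : ℝ} (hB : 0 ≤ B) (hs : ∀ i, s i ≤ B) (n : ℕ) :
    runningMax s n ≤ B :=
  Finset.fold_max_le _ |>.2 ⟨hB, fun i _ => hs i⟩

end RunningMax

section ConeNetwork

variable {d : ℕ}

/-- The neurons of a hidden layer of the cone network: for each coordinate the positive and the
negative part of its distance to the current centre, and two neurons whose sum is the running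
maximum of the cones evaluated so far (the previous running maximum, `false`, and the last
increment, `true`). -/
abbrev ConeNeuron (d : ℕ) : Type := Fin d ⊕ Fin d ⊕ Bool

/-- The position of a neuron in its layer. The positive parts come first, so that a point of the
unit cube is itself a state for the centre `0`. -/
def coneIndex : ConeNeuron d → ℕ
  | .inl k => k
  | .inr (.inl k) => d + k
  | .inr (.inr b) => 2 * d + b.toNat

lemma coneIndex_lt (t : ConeNeuron d) : coneIndex t < 2 * d + 2 := by
  rcases t with k | k | b <;> simp only [coneIndex]
  · omega
  · omega
  · cases b <;> simp

lemma coneIndex_injective : Function.Injective (coneIndex (d := d)) := by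
  rintro (k | k | _ | _) (k' | k' | _ | _) h <;>
    simp only [coneIndex, Bool.toNat_true, Bool.toNat_false] at h <;>
    first | rfl | (exfalso; omega) | (congr; omega)

/-- The weights `target → source → ℝ` between consecutive layers of the cone network with slope
`lam`. -/
noncomputable def coneWeight (lam : ℝ) : ConeNeuron d → ConeNeuron d → ℝ
  | .inl k => Sum.elim (Pi.single k 1) (Sum.elim (-Pi.single k 1) 0)
  | .inr (.inl k) => Sum.elim (-Pi.single k 1) (Sum.elim (Pi.single k 1) 0)
  | .inr (.inr false) => Sum.elim 0 (Sum.elim 0 1)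
  | .inr (.inr true) => Sum.elim (fun _ => -lam) (Sum.elim (fun _ => -lam) (-1))

/-- The biases of layer `i + 1` of the cone network with centres `q` and heights `y`. -/
def coneBias (q : ℕ → UnitCube d) (y : ℕ → unitInterval) (i : ℕ) : ConeNeuron d → ℝ
  | .inl k => (q i : Fin d → ℝ) k - (q (i + 1) : Fin d → ℝ) k
  | .inr (.inl k) => (q (i + 1) : Fin d → ℝ) k - (q i : Fin d → ℝ) k
  | .inr (.inr false) => 0
  | .inr (.inr true) => y i

/-- The value at `x` of the cone with centre `q i`, height `y i` and slope `lam`. -/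
noncomputable def coneValue (lam : ℝ) (q : ℕ → UnitCube d) (y : ℕ → unitInterval) (x : UnitCube d)
    (i : ℕ) : ℝ :=
  y i - lam * ∑ k, |(x : Fin d → ℝ) k - (q i : Fin d → ℝ) k|

/-- The values of the neurons in layer `i` of the cone network on input `x`. -/
noncomputable def coneState (lam : ℝ) (q : ℕ → UnitCube d) (y : ℕ → unitInterval) (x : UnitCube d)
    (i : ℕ) : ConeNeuron d → ℝ
  | .inl k => max ((x : Fin d → ℝ) k - (q i : Fin d → ℝ) k) 0
  | .inr (.inl k) => max ((q i : Fin d → ℝ) k - (x : Fin d → ℝ) k) 0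
  | .inr (.inr false) => runningMax (coneValue lam q y x) (i - 1)
  | .inr (.inr true) =>
      runningMax (coneValue lam q y x) i - runningMax (coneValue lam q y x) (i - 1)

lemma abs_coneWeight_le {lam c : ℝ} (hc : 1 ≤ c) (hlam0 : 0 ≤ lam) (hlam : lam ≤ c)
    (t u : ConeNeuron d) : |coneWeight lam t u| ≤ c := by
  have hsingle : ∀ k j : Fin d, |(Pi.single k 1 : Fin d → ℝ) j| ≤ c := fun k j => by
    rw [Pi.single_apply]; split_ifs <;> simp <;> linarith
  rcases t with k | k | _ | _ <;> rcases u with j | j | _ | _ <;>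
    simp only [coneWeight, Sum.elim_inl, Sum.elim_inr, Pi.neg_apply, Pi.zero_apply, Pi.one_apply,
      abs_neg, abs_zero, abs_one, abs_of_nonneg hlam0, hsingle] <;> linarith

lemma abs_coneBias_le {c : ℝ} (hc : 1 ≤ c) (q : ℕ → UnitCube d) (y : ℕ → unitInterval) (i : ℕ)
    (t : ConeNeuron d) : |coneBias q y i t| ≤ c := by
  have hq : ∀ i j k, |(q i : Fin d → ℝ) k - (q j : Fin d → ℝ) k| ≤ c := fun i j k =>
    (abs_sub_le_one_of_mem_Icc ⟨(q i).2.1 k, (q i).2.2 k⟩ ⟨(q j).2.1 k, (q j).2.2 k⟩).trans hc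
  rcases t with k | k | _ | _
  · exact hq _ _ _
  · exact hq _ _ _
  · simpa [coneBias] using zero_le_one.trans hc
  · simpa [coneBias, abs_of_nonneg (y i).2.1] using (y i).2.2.trans hc

lemma max_zero_sub_max_zero (a b : ℝ) : max (a - b) 0 - max (b - a) 0 = a - b := by
  rw [← neg_sub a b, max_zero_sub_eq_self]

lemma max_zero_add_max_zero (a b : ℝ) : max (a - b) 0 + max (b - a) 0 = |a - b| := by
  rw [← neg_sub a b, max_zero_add_max_neg_zero_eq_abs_self]

lemma sum_coneWeight_mul (lam : ℝ) (S : ConeNeuron d → ℝ) (t : ConeNeuron d) :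
    ∑ u, coneWeight lam t u * S u = match t with
      | .inl k => S (.inl k) - S (.inr (.inl k))
      | .inr (.inl k) => S (.inr (.inl k)) - S (.inl k)
      | .inr (.inr false) => S (.inr (.inr false)) + S (.inr (.inr true))
      | .inr (.inr true) => -(lam * ∑ k, (S (.inl k) + S (.inr (.inl k))))
          - (S (.inr (.inr false)) + S (.inr (.inr true))) := by
  rcases t with k | k | _ | _ <;>
    simp only [coneWeight, Fintype.sum_sum_type, Sum.elim_inl, Sum.elim_inr, Pi.neg_apply,
      Pi.zero_apply, Pi.one_apply, Pi.single_apply, Fintype.sum_bool, neg_mul, ite_mul, one_mul,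
      zero_mul, Finset.sum_neg_distrib, Finset.sum_ite_eq', Finset.mem_univ, if_true,
      Finset.sum_const_zero, Finset.mul_sum, mul_add, Finset.sum_add_distrib] <;>
    ring

lemma coneState_succ (lam : ℝ) (q : ℕ → UnitCube d) (y : ℕ → unitInterval) (x : UnitCube d) (i : ℕ)
    (t : ConeNeuron d) :
    max ((∑ u, coneWeight lam t u * coneState lam q y x i u) + coneBias q y i t) 0
      = coneState lam q y x (i + 1) t := by
  rw [sum_coneWeight_mul]
  rcases t with k | k | _ | _ <;> simp only [coneState, coneBias, Nat.add_sub_cancel]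
  · rw [max_zero_sub_max_zero]; ring_nf
  · rw [max_zero_sub_max_zero]; ring_nf
  · rw [add_zero, add_sub_cancel, max_eq_left (runningMax_nonneg _ _)]
  · simp only [max_zero_add_max_zero, add_sub_cancel]
    rw [runningMax_succ, ← max_sub_sub_right, sub_self, coneValue]
    ring_nf

lemma sum_extend_coneIndex_mul {n : ℕ} (f : ConeNeuron d → ℝ) (h : Fin n → ℝ) :
    ∑ j : Fin n, Function.extend coneIndex f 0 j * h j = ∑ u, f u * param h (coneIndex u) := by
  set F : ℕ → ℝ := fun j => Function.extend coneIndex f 0 j * param h j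
  set I : Finset ℕ := Finset.univ.image (coneIndex (d := d))
  calc ∑ j : Fin n, Function.extend coneIndex f 0 j * h j = ∑ j ∈ Finset.range n, F j := by
        rw [Finset.sum_range]; simp [F, param]
    _ = ∑ j ∈ Finset.range n ∪ I, F j := by
        refine Finset.sum_subset Finset.subset_union_left fun j _ hj => ?_
        simp only [F, param, dif_neg (Finset.mem_range.not.1 hj), mul_zero]
    _ = ∑ j ∈ I, F j := by
        refine (Finset.sum_subset Finset.subset_union_right fun j _ hj => ?_).symm
        have hj' : ¬∃ u : ConeNeuron d, coneIndex u = j := by simpa [I] using hj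
        simp only [F, Function.extend_apply' _ _ _ hj', Pi.zero_apply, zero_mul]
    _ = ∑ u, f u * param h (coneIndex u) := by
        rw [Finset.sum_image coneIndex_injective.injOn]
        simp only [F, coneIndex_injective.extend_apply]

lemma abs_extend_zero_le {α β : Type*} {e : α → β} {f : α → ℝ} {c : ℝ} (hc : 0 ≤ c)
    (hf : ∀ a, |f a| ≤ c) (b : β) : |Function.extend e f 0 b| ≤ c := by
  classical
  rw [Function.extend_def]
  split_ifs
  exacts [hf _, by simpa using hc]

lemma param_coneIndex_eq_coneState_zero (lam : ℝ) {q : ℕ → UnitCube d} (hq : q 0 = 0)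
    (y : ℕ → unitInterval) (x : UnitCube d) (t : ConeNeuron d) :
    param (x : Fin d → ℝ) (coneIndex t) = coneState lam q y x 0 t := by
  have hq0 : ∀ k, (q 0 : Fin d → ℝ) k = 0 := fun k => by rw [hq]; rfl
  rcases t with k | k | _ | _
  · simpa [param, coneIndex, coneState, hq0] using x.2.1 k
  · simpa [param, coneIndex, coneState, hq0] using x.2.1 k
  · simp [param, coneIndex, coneState, runningMax_zero, two_mul]
  · simpa [param, coneIndex, coneState, two_mul] using fun h => absurd h (by omega)

lemma param_hiddenLayer_eq_coneState {D n : ℕ} {l : ℕ → ℕ} {lam : ℝ} {q : ℕ → UnitCube (l 0)}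
    (hq : q 0 = 0) {y : ℕ → unitInterval} {θ : Fin D → ℝ} (hl : ∀ i < n, 2 * l 0 + 2 ≤ l (i + 1))
    (hθ : ∀ i < n, ∀ t (ht : coneIndex t < l (i + 1)) (h : Fin (l i) → ℝ),
      affineMap θ (numParams l i) (l (i + 1)) (l i) h ⟨coneIndex t, ht⟩
        = (∑ u, coneWeight lam t u * param h (coneIndex u)) + coneBias q y i t)
    (x : UnitCube (l 0)) (t : ConeNeuron (l 0)) :
    param (hiddenLayer θ l n x) (coneIndex t) = coneState lam q y x n t := by
  induction n generalizing t with
  | zero => exact param_coneIndex_eq_coneState_zero lam hq y x t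
  | succ n ih =>
    have hn := n.lt_succ_self
    have ht := (coneIndex_lt t).trans_le (hl n hn)
    rw [param, dif_pos ht, ← coneState_succ]
    simp only [hiddenLayer, hθ n hn t ht,
      ih (fun i hi => hl i (hi.trans hn)) fun i hi => hθ i (hi.trans hn)]

theorem exists_clippedNN_eq_runningMax {L : ℕ} {l : ℕ → ℕ} (hL : 1 ≤ L) (hl0 : l 0 = d)
    (hlL : l L = 1) (hl : ∀ i, 1 ≤ i → i < L → 2 * d + 2 ≤ l i) {lam c : ℝ} (hc : 1 ≤ c)
    (hlam0 : 0 ≤ lam) (hlam : lam ≤ c) {q : ℕ → UnitCube d} (hq : q 0 = 0)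
    (y : ℕ → unitInterval) :
    ∃ θ : Fin (numParams l L) → ℝ, ‖θ‖ ≤ c ∧ ∀ x : UnitCube d,
      clippedNN L l hl0 θ x = clip (runningMax (coneValue lam q y x) (L - 1)) := by
  subst hl0
  obtain ⟨n, rfl⟩ : ∃ n, L = n + 1 := ⟨L - 1, by omega⟩
  have hc0 : 0 ≤ c := zero_le_one.trans hc
  -- The output neuron adds up the two running maximum neurons, as every neuron `false` does.
  let wt (i r j : ℕ) : ℝ := if i = n
    then Function.extend coneIndex (coneWeight (d := l 0) lam (.inr (.inr false))) 0 j
    else Function.extend coneIndex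
      (fun t => Function.extend coneIndex (coneWeight (d := l 0) lam t) 0 j) 0 r
  let b (i r : ℕ) : ℝ := if i = n then 0 else Function.extend coneIndex (coneBias q y i) 0 r
  have hrow : ∀ t j, |Function.extend coneIndex (coneWeight (d := l 0) lam t) 0 j| ≤ c := fun t =>
    abs_extend_zero_le hc0 (abs_coneWeight_le hc hlam0 hlam t)
  obtain ⟨θ, hθc, hθ⟩ := exists_params_affineMap_eq (l := l) (n := n + 1) (wt := wt) (b := b) hc0
    (fun i r j => by
      dsimp only [wt]
      split_ifs
      exacts [hrow _ _, abs_extend_zero_le hc0 (fun t => hrow t j) r])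
    (fun i r => by
      dsimp only [b]
      split_ifs
      exacts [by simpa using hc0, abs_extend_zero_le hc0 (abs_coneBias_le hc q y i) r])
  refine ⟨θ, hθc, fun x => ?_⟩
  have hstate := param_hiddenLayer_eq_coneState (θ := θ) (lam := lam) (y := y) (n := n) hq
    (fun i hi => hl (i + 1) (by omega) (by omega))
    (fun i hi t ht h => by
      rw [hθ i (by omega)]
      simp only [wt, b, if_neg hi.ne, coneIndex_injective.extend_apply, sum_extend_coneIndex_mul])
    x
  have hout : ∀ m, l (n + 1) = m → ∀ r : Fin m,
      affineMap θ (numParams l n) m (l n) (hiddenLayer θ l n x) r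
        = runningMax (coneValue lam q y x) n := by
    rintro _ rfl r
    rw [hθ n n.lt_succ_self]
    simp only [wt, b, if_true, sum_extend_coneIndex_mul, hstate, sum_coneWeight_mul, coneState,
      add_sub_cancel, add_zero]
  exact congrArg clip (hout 1 hlL 0)

end ConeNetwork

section Grid

lemma exists_mul_mem_Icc_natCast {N : ℕ} (hN : 0 < N) {u : ℝ} (hu : u ∈ Set.Icc (0 : ℝ) 1) :
    ∃ g : Fin N, u * N ∈ Set.Icc ((g : ℕ) : ℝ) ((g : ℕ) + 1) := by
  have huN : 0 ≤ u * N := mul_nonneg hu.1 N.cast_nonneg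
  by_cases h : ⌊u * N⌋₊ < N
  · exact ⟨⟨_, h⟩, Nat.floor_le huN, (Nat.lt_floor_add_one _).le⟩
  · have hN' : ((N - 1 : ℕ) : ℝ) + 1 = N := by exact_mod_cast Nat.sub_add_cancel hN
    have hle : (N : ℝ) ≤ u * N := (Nat.cast_le.2 (not_lt.1 h)).trans (Nat.floor_le huN)
    refine ⟨⟨N - 1, by omega⟩, ?_, ?_⟩
    · dsimp only; linarith
    · dsimp only; rw [hN']; exact mul_le_of_le_one_left N.cast_nonneg hu.2

/-- The midpoints of the `N` intervals of equal length into which `[a, b]` is divided. -/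
noncomputable def gridPoint {N : ℕ} (a b : ℝ) (g : Fin N) : ℝ :=
  a + (b - a) * ((2 * (g : ℕ) + 1) / (2 * N))

lemma gridPoint_mem_Icc {N : ℕ} {a b : ℝ} (hab : a ≤ b) (g : Fin N) :
    gridPoint a b g ∈ Set.Icc a b := by
  have hN : (0 : ℝ) < N := by exact_mod_cast g.pos
  have hg : ((g : ℕ) : ℝ) + 1 ≤ N := by exact_mod_cast g.2
  have h0 : 0 ≤ (2 * ((g : ℕ) : ℝ) + 1) / (2 * N) := by positivity
  have h1 : (2 * ((g : ℕ) : ℝ) + 1) / (2 * N) ≤ 1 := by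
    rw [div_le_one (by positivity)]; linarith
  constructor
  · exact le_add_of_nonneg_right (mul_nonneg (sub_nonneg.2 hab) h0)
  · rw [gridPoint]; nlinarith

lemma exists_abs_sub_gridPoint_le {N : ℕ} (hN : 0 < N) {a b t : ℝ} (ht : t ∈ Set.Icc a b) :
    ∃ g : Fin N, |t - gridPoint a b g| ≤ (b - a) / (2 * N) := by
  obtain ⟨hat, htb⟩ := ht
  have hab : 0 ≤ b - a := by linarith
  have hu : (t - a) / (b - a) ∈ Set.Icc (0 : ℝ) 1 :=
    ⟨div_nonneg (by linarith) hab, div_le_one_of_le₀ (by linarith) hab⟩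
  have htu : t = a + (b - a) * ((t - a) / (b - a)) := by
    rcases hab.eq_or_lt with h | h
    · rw [← h]; linarith
    · rw [mul_div_cancel₀ _ h.ne']; ring
  obtain ⟨g, hg0, hg1⟩ := exists_mul_mem_Icc_natCast hN hu
  set u := (t - a) / (b - a)
  refine ⟨g, ?_⟩
  have hdiff : t - gridPoint a b g = (b - a) * ((2 * (u * N) - (2 * (g : ℕ) + 1)) / (2 * N)) := by
    rw [htu, gridPoint]; field_simp; ring
  rw [hdiff, abs_mul, abs_of_nonneg hab, abs_div, abs_of_pos (by positivity : (0 : ℝ) < 2 * N),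
    ← mul_div_assoc]
  gcongr
  exact mul_le_of_le_one_right hab (abs_le.2 ⟨by linarith, by linarith⟩)

end Grid

section Approximation

variable {d L : ℕ} {l : ℕ → ℕ} {c : ℝ} {E : UnitCube d → unitInterval}

lemma abs_runningMax_coneValue_sub_le {q : ℕ → UnitCube d} {n : ℕ} {δ : ℝ} (hc : 0 ≤ c)
    (hE : ∀ x y : UnitCube d,
      |(E x : ℝ) - (E y : ℝ)| ≤ c * ∑ i, |(x : Fin d → ℝ) i - (y : Fin d → ℝ) i|)
    {x : UnitCube d} (hx : ∃ i < n, ∑ k, |(x : Fin d → ℝ) k - (q i : Fin d → ℝ) k| ≤ δ) :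
    |runningMax (coneValue c q (E ∘ q) x) n - E x| ≤ 2 * c * δ := by
  obtain ⟨i, hi, hxi⟩ := hx
  have hδ : 0 ≤ c * δ := mul_nonneg hc ((Finset.sum_nonneg fun k _ => abs_nonneg _).trans hxi)
  have hupper : runningMax (coneValue c q (E ∘ q) x) n ≤ E x :=
    runningMax_le (E x).2.1 (fun j => by
      rw [coneValue, Function.comp_apply]; linarith [(abs_le.1 (hE x (q j))).1]) n
  have hcone : (E (q i) : ℝ) - c * δ ≤ runningMax (coneValue c q (E ∘ q) x) n :=
    (sub_le_sub_left (mul_le_mul_of_nonneg_left hxi hc) _).trans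
      (le_runningMax (coneValue c q (E ∘ q) x) hi)
  have hLip : (E x : ℝ) - E (q i) ≤ c * δ :=
    (abs_le.1 (hE x (q i))).2.trans (mul_le_mul_of_nonneg_left hxi hc)
  exact abs_le.2 ⟨by linarith, by linarith⟩

lemma exists_clippedNN_approx_of_net {ι : Type*} [Fintype ι] (hL : 1 ≤ L) (hl0 : l 0 = d)
    (hlL : l L = 1) (hl : ∀ i, 1 ≤ i → i < L → 2 * d + 2 ≤ l i) (hc : 1 ≤ c)
    (hE : ∀ x y : UnitCube d,
      |(E x : ℝ) - (E y : ℝ)| ≤ c * ∑ i, |(x : Fin d → ℝ) i - (y : Fin d → ℝ) i|)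
    (pts : ι → UnitCube d) (hcard : Fintype.card ι + 2 ≤ L) {δ : ℝ}
    (hpts : ∀ x : UnitCube d, ∃ g, ∑ k, |(x : Fin d → ℝ) k - (pts g : Fin d → ℝ) k| ≤ δ) :
    ∃ θ : Fin (numParams l L) → ℝ, ‖θ‖ ≤ c ∧ ∀ x : UnitCube d,
      |clippedNN L l hl0 θ x - E x| ≤ 2 * c * δ := by
  have hc0 : 0 ≤ c := zero_le_one.trans hc
  let idx (g : ι) : ℕ := Fintype.equivFin ι g + 1
  have hidx : Function.Injective idx := fun g g' h =>
    (Fintype.equivFin ι).injective (Fin.ext (Nat.succ_injective h))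
  let q : ℕ → UnitCube d := Function.extend idx pts 0
  have hq0 : q 0 = 0 := Function.extend_apply' _ _ _ (by simp [idx])
  obtain ⟨θ, hθ, hθx⟩ := exists_clippedNN_eq_runningMax hL hl0 hlL hl hc hc0 le_rfl hq0 (E ∘ q)
  refine ⟨θ, hθ, fun x => ?_⟩
  obtain ⟨g, hg⟩ := hpts x
  rw [hθx, ← clip_of_mem_Icc (E x).2]
  refine (abs_clip_sub_clip_le _ _).trans (abs_runningMax_coneValue_sub_le hc0 hE ⟨idx g, ?_, ?_⟩)
  · have := (Fintype.equivFin ι g).2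
    dsimp only [idx]
    omega
  · rwa [show q (idx g) = pts g from hidx.extend_apply _ _ _]

lemma exists_gridSize {d A : ℕ} {a : ℝ} (hd : 1 ≤ d) (ha : a ^ d = A) (ha8 : 8 * d ≤ a) :
    ∃ N : ℕ, 0 < N ∧ N ^ d + 2 ≤ A ∧ a ≤ 4 * N := by
  have hd1 : (1 : ℝ) ≤ d := by exact_mod_cast hd
  have ha0 : 0 ≤ a / 2 := by linarith
  have hlt := Nat.lt_floor_add_one (a / 2)
  have hpow : (⌊a / 2⌋₊ : ℝ) ^ d ≤ A / 2 := by
    calc (⌊a / 2⌋₊ : ℝ) ^ d ≤ (a / 2) ^ d := by gcongr; exact Nat.floor_le ha0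
      _ = A / 2 ^ d := by rw [div_pow, ha]
      _ ≤ A / 2 := by gcongr; exact le_self_pow₀ one_le_two (by omega)
  have haA : a ≤ A := ha ▸ le_self_pow₀ (by linarith) (by omega)
  refine ⟨⌊a / 2⌋₊, Nat.floor_pos.2 (by linarith), ?_, by linarith⟩
  have h : ((⌊a / 2⌋₊ ^ d + 2 : ℕ) : ℝ) ≤ A := by push_cast; linarith
  exact_mod_cast h

theorem exists_clippedNN_approx (hd : 1 ≤ d) (hl0 : l 0 = d) (hlL : l L = 1) (hc : 2 ≤ c)
    (hE : ∀ x y : UnitCube d,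
      |(E x : ℝ) - (E y : ℝ)| ≤ c * ∑ i, |(x : Fin d → ℝ) i - (y : Fin d → ℝ) i|)
    (hpos : 0 < minSize L l) (hlt : (d : ℝ) * c ^ 3 / (minSize L l : ℝ) ^ (1 / (d : ℝ)) < 1) :
    ∃ θ : Fin (numParams l L) → ℝ, ‖θ‖ ≤ c ∧ ∀ x : UnitCube d,
      |clippedNN L l hl0 θ x - E x| ≤ d * c ^ 3 / (minSize L l : ℝ) ^ (1 / (d : ℝ)) := by
  set a : ℝ := (minSize L l : ℝ) ^ (1 / (d : ℝ))
  have hd1 : (1 : ℝ) ≤ d := by exact_mod_cast hd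
  have ha0 : 0 < a := Real.rpow_pos_of_pos (by exact_mod_cast hpos) _
  have hapow : a ^ d = minSize L l := by
    simp only [a, one_div, Real.rpow_inv_natCast_pow (Nat.cast_nonneg _) (by omega : d ≠ 0)]
  have hc3 : 4 * c ≤ c ^ 3 := by nlinarith [mul_nonneg (by linarith : 0 ≤ c - 2) (sq_nonneg c)]
  have ha8 : 8 * (d : ℝ) ≤ a := by
    rw [div_lt_one ha0] at hlt; nlinarith
  obtain ⟨N, hN, hNA, haN⟩ := exists_gridSize hd hapow ha8
  have hN' : (0 : ℝ) < N := by exact_mod_cast hN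
  have hAL := minSize_le_depth L l
  have hwidth : ∀ i, 1 ≤ i → i < L → 2 * d + 2 ≤ l i := by
    intro i h1 hi
    have hA : 8 * (d : ℝ) ≤ minSize L l :=
      ha8.trans (hapow ▸ le_self_pow₀ (by linarith) (by omega))
    have hA' : 8 * d ≤ minSize L l := by exact_mod_cast hA
    have := minSize_le_width l h1 hi
    omega
  obtain ⟨θ, hθ, hθx⟩ := exists_clippedNN_approx_of_net (ι := Fin d → Fin N)
    (δ := d * (1 / (2 * N)))
    (by omega) hl0 hlL hwidth (by linarith) hE
    (fun g => ⟨fun k => gridPoint 0 1 (g k), fun k => (gridPoint_mem_Icc zero_le_one _).1,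
      fun k => (gridPoint_mem_Icc zero_le_one _).2⟩)
    (by simpa using hNA.trans hAL) (fun x => by
      choose g hg using fun k : Fin d =>
        exists_abs_sub_gridPoint_le hN (a := 0) (b := 1) ⟨x.2.1 k, x.2.2 k⟩
      rw [sub_zero] at hg
      exact ⟨g, (Finset.sum_le_card_nsmul _ _ _ fun k _ => hg k).trans_eq (by simp)⟩)
  refine ⟨θ, hθ, fun x => (hθx x).trans ?_⟩
  calc 2 * c * (d * (1 / (2 * N))) = c * d / N := by field_simp
    _ ≤ d * c ^ 3 / a := by
      rw [div_le_div_iff₀ hN' ha0]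
      calc c * d * a ≤ c * d * (4 * N) := by gcongr
        _ = d * (4 * c) * N := by ring
        _ ≤ d * c ^ 3 * N := by gcongr

end Approximation

section Deviation

variable {Ω : Type*} [MeasurableSpace Ω] {P : Measure Ω}

lemma integral_exp_mul_abs_le_of_hasSubgaussianMGF {T : Ω → ℝ} {v : NNReal}
    (hT : HasSubgaussianMGF T v P) (t : ℝ) :
    ∫ ω, Real.exp (t * |T ω|) ∂P ≤ 2 * Real.exp (v * t ^ 2 / 2) := by
  have hpos := hT.integrable_exp_mul t
  have hneg := hT.integrable_exp_mul (-t)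
  calc ∫ ω, Real.exp (t * |T ω|) ∂P
      ≤ ∫ ω, (Real.exp (t * T ω) + Real.exp (-t * T ω)) ∂P := by
        refine integral_mono (integrable_exp_mul_abs hpos hneg) (hpos.add hneg) fun ω => ?_
        rcases abs_choice (T ω) with h | h
        · simpa only [h] using le_add_of_nonneg_right (Real.exp_pos _).le
        · simpa only [h, mul_neg, neg_mul] using le_add_of_nonneg_left (Real.exp_pos _).le
    _ = mgf T P t + mgf T P (-t) := integral_add hpos hneg
    _ ≤ Real.exp (v * t ^ 2 / 2) + Real.exp (v * (-t) ^ 2 / 2) :=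
        add_le_add (hT.mgf_le t) (hT.mgf_le (-t))
    _ = 2 * Real.exp (v * t ^ 2 / 2) := by rw [neg_sq, two_mul]

-- The tangent line of the logarithm at `card ι * B` turns the maximum into a sum of exponentials.
lemma exists_integrable_bound_of_integral_exp_le [IsProbabilityMeasure P] {ι : Type*} [Fintype ι]
    [Nonempty ι] {F : ι → Ω → ℝ} {B : ℝ} (hB0 : 0 < B)
    (hF : ∀ i, Integrable (fun ω => Real.exp (F i ω)) P)
    (hB : ∀ i, ∫ ω, Real.exp (F i ω) ∂P ≤ B) :
    ∃ S : Ω → ℝ, Integrable S P ∧ (∀ i ω, F i ω ≤ S ω) ∧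
      ∫ ω, S ω ∂P ≤ Real.log (Fintype.card ι * B) := by
  set a : ℝ := Fintype.card ι * B with ha
  have ha0 : 0 < a := mul_pos (by exact_mod_cast Fintype.card_pos) hB0
  have hsum : Integrable (fun ω => ∑ i, Real.exp (F i ω)) P :=
    integrable_finsetSum _ fun i _ => hF i
  refine ⟨fun ω => (Real.log a - 1) + a⁻¹ * ∑ i, Real.exp (F i ω),
    (integrable_const _).add (hsum.const_mul _), fun i ω => ?_, ?_⟩
  · have htangent := Real.log_le_sub_one_of_pos (show 0 < a⁻¹ * Real.exp (F i ω) by positivity)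
    rw [Real.log_mul (by positivity) (by positivity), Real.log_inv, Real.log_exp] at htangent
    have hterm : a⁻¹ * Real.exp (F i ω) ≤ a⁻¹ * ∑ i, Real.exp (F i ω) := by
      gcongr
      exact Finset.single_le_sum (f := fun i => Real.exp (F i ω)) (fun _ _ => (Real.exp_pos _).le)
        (Finset.mem_univ i)
    linarith
  · have hmoment : ∑ i, ∫ ω, Real.exp (F i ω) ∂P ≤ a :=
      (Finset.sum_le_card_nsmul _ _ B fun i _ => hB i).trans (by simp [ha])
    rw [integral_add (integrable_const _) (hsum.const_mul _), integral_const_mul,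
      integral_finsetSum _ fun i _ => hF i, integral_const, probReal_univ, one_smul]
    linarith [(inv_mul_le_one₀ ha0).2 hmoment]

variable {β : Type*} {z : ℕ → Ω → β} {f g : β → ℝ} {M : ℕ} {ε : ℝ}

/-- The distance between the average of `f` over the sample `z 0, …, z (M - 1)` and the expectation
of `f (z 0)`. -/
noncomputable def sampleDeviation (P : Measure Ω) (z : ℕ → Ω → β) (M : ℕ) (f : β → ℝ) (ω : Ω) :
    ℝ :=
  |1 / (M : ℝ) * ∑ j ∈ Finset.range M, f (z j ω) - ∫ ω', f (z 0 ω') ∂P|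

lemma abs_average_sub_le (hM : 1 ≤ M) (hfg : ∀ b, |f b - g b| ≤ ε) (x : ℕ → β) :
    |1 / (M : ℝ) * ∑ j ∈ Finset.range M, f (x j) - 1 / (M : ℝ) * ∑ j ∈ Finset.range M, g (x j)|
      ≤ ε := by
  have hM0 : (0 : ℝ) < M := by exact_mod_cast hM
  rw [← mul_sub, ← Finset.sum_sub_distrib, abs_mul, abs_of_pos (by positivity), one_div,
    inv_mul_le_iff₀ hM0]
  exact (Finset.abs_sum_le_sum_abs _ _).trans
    ((Finset.sum_le_card_nsmul _ _ ε fun j _ => hfg _).trans_eq (by simp))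

variable [MeasurableSpace β] [IsProbabilityMeasure P]

lemma integrable_comp_of_mem_Icc {Z : Ω → β} (hZ : Measurable Z) (hf : Measurable f)
    (hf01 : ∀ b, f b ∈ Set.Icc (0 : ℝ) 1) : Integrable (fun ω => f (Z ω)) P :=
  Integrable.of_mem_Icc 0 1 (hf.comp hZ).aemeasurable (.of_forall fun ω => hf01 (Z ω))

lemma abs_integral_sub_le {Z : Ω → β} (hZ : Measurable Z) (hf : Measurable f) (hg : Measurable g)
    (hf01 : ∀ b, f b ∈ Set.Icc (0 : ℝ) 1) (hg01 : ∀ b, g b ∈ Set.Icc (0 : ℝ) 1)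
    (hfg : ∀ b, |f b - g b| ≤ ε) : |∫ ω, f (Z ω) ∂P - ∫ ω, g (Z ω) ∂P| ≤ ε := by
  rw [← integral_sub (integrable_comp_of_mem_Icc hZ hf hf01)
    (integrable_comp_of_mem_Icc hZ hg hg01)]
  exact (norm_integral_le_of_norm_le_const (μ := P) (f := fun ω => f (Z ω) - g (Z ω))
    (.of_forall fun ω => hfg (Z ω))).trans_eq (by rw [probReal_univ, mul_one])

lemma sampleDeviation_le_add (hz : Measurable (z 0)) (hM : 1 ≤ M)
    (hf : Measurable f) (hg : Measurable g)
    (hf01 : ∀ b, f b ∈ Set.Icc (0 : ℝ) 1) (hg01 : ∀ b, g b ∈ Set.Icc (0 : ℝ) 1)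
    (hfg : ∀ b, |f b - g b| ≤ ε) (ω : Ω) :
    sampleDeviation P z M f ω ≤ sampleDeviation P z M g ω + 2 * ε := by
  have havg := abs_le.1 (abs_average_sub_le hM hfg fun j => z j ω)
  have hint := abs_le.1 (abs_integral_sub_le (P := P) hz hf hg hf01 hg01 hfg)
  unfold sampleDeviation
  rw [abs_le]
  constructor
  · linarith [neg_abs_le (1 / (M : ℝ) * ∑ j ∈ Finset.range M, g (z j ω) - ∫ ω', g (z 0 ω') ∂P)]
  · linarith [le_abs_self (1 / (M : ℝ) * ∑ j ∈ Finset.range M, g (z j ω) - ∫ ω', g (z 0 ω') ∂P)]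

section Sample

variable (hz : ∀ j, Measurable (z j)) (hindep : iIndepFun z P)
  (hident : ∀ j, IdentDistrib (z j) (z 0) P P)

include hz hindep hident

lemma hasSubgaussianMGF_sum_sub (hf : Measurable f) (hf01 : ∀ b, f b ∈ Set.Icc (0 : ℝ) 1) (M : ℕ) :
    HasSubgaussianMGF (fun ω => ∑ j ∈ Finset.range M, (f (z j ω) - ∫ ω', f (z 0 ω') ∂P))
      (M / 4) P := by
  have hsummand : ∀ j ∈ Finset.range M,
      HasSubgaussianMGF (fun ω => f (z j ω) - ∫ ω', f (z 0 ω') ∂P) (1 / 4) P := by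
    intro j _
    have h := hasSubgaussianMGF_of_mem_Icc (hf.comp (hz j)).aemeasurable
      (.of_forall fun ω => hf01 (z j ω)) (μ := P)
    rw [((hident j).comp hf).integral_eq] at h
    norm_num at h
    simpa using h
  have hcenter : Measurable fun b => f b - ∫ ω', f (z 0 ω') ∂P := hf.sub_const _
  have hsum := HasSubgaussianMGF.sum_of_iIndepFun (hindep.comp _ fun _ => hcenter) hsummand
  rwa [Finset.sum_const, Finset.card_range, nsmul_eq_mul, mul_one_div] at hsum

lemma integral_exp_sqrt_mul_sampleDeviation_le (hf : Measurable f)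
    (hf01 : ∀ b, f b ∈ Set.Icc (0 : ℝ) 1) (hM : 1 ≤ M) :
    Integrable (fun ω => Real.exp (√M * sampleDeviation P z M f ω)) P ∧
      ∫ ω, Real.exp (√M * sampleDeviation P z M f ω) ∂P ≤ Real.exp 1 := by
  have hM0 : (0 : ℝ) < M := by exact_mod_cast hM
  set T : Ω → ℝ := fun ω => ∑ j ∈ Finset.range M, (f (z j ω) - ∫ ω', f (z 0 ω') ∂P) with hT
  have hsub : HasSubgaussianMGF T (M / 4) P := hasSubgaussianMGF_sum_sub hz hindep hident hf hf01 M
  have heq : ∀ ω, √M * sampleDeviation P z M f ω = (√M)⁻¹ * |T ω| := by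
    intro ω
    have hmean : 1 / (M : ℝ) * ∑ j ∈ Finset.range M, f (z j ω) - ∫ ω', f (z 0 ω') ∂P
        = (M : ℝ)⁻¹ * T ω := by
      simp only [hT, Finset.sum_sub_distrib, Finset.sum_const, Finset.card_range, nsmul_eq_mul]
      field_simp
    rw [sampleDeviation, hmean, abs_mul, abs_of_pos (inv_pos.2 hM0), ← mul_assoc,
      ← Real.sqrt_div_self, div_eq_mul_inv]
  simp only [heq]
  refine ⟨integrable_exp_mul_abs (hsub.integrable_exp_mul _) (hsub.integrable_exp_mul _), ?_⟩
  have hvar : ((M / 4 : NNReal) : ℝ) * (√(M : ℝ))⁻¹ ^ 2 / 2 = 1 / 8 := by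
    push_cast
    rw [inv_pow, Real.sq_sqrt hM0.le]
    field_simp
    norm_num
  calc ∫ ω, Real.exp ((√M)⁻¹ * |T ω|) ∂P ≤ 2 * Real.exp (1 / 8) :=
        hvar ▸ integral_exp_mul_abs_le_of_hasSubgaussianMGF hsub _
    _ ≤ Real.exp (7 / 8) * Real.exp (1 / 8) := by
        gcongr
        rw [← Real.log_le_iff_le_exp two_pos]
        linarith [Real.log_two_lt_d9]
    _ = Real.exp 1 := by rw [← Real.exp_add]; norm_num

theorem exists_uniform_sampleDeviation_bound {ι : Type*} [Fintype ι] [Nonempty ι] {f : ι → β → ℝ}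
    (hf : ∀ i, Measurable (f i)) (hf01 : ∀ i b, f i b ∈ Set.Icc (0 : ℝ) 1) (hM : 1 ≤ M) (ε : ℝ) :
    ∃ S : Ω → ℝ, Integrable S P ∧
      (∀ (g : β → ℝ) (i : ι), Measurable g → (∀ b, g b ∈ Set.Icc (0 : ℝ) 1) →
        (∀ b, |g b - f i b| ≤ ε) → ∀ ω, sampleDeviation P z M g ω ≤ S ω) ∧
      ∫ ω, S ω ∂P ≤ (Real.log (Fintype.card ι) + 1) / √M + 2 * ε := by
  have hM0 : 0 < √(M : ℝ) := Real.sqrt_pos.2 (by exact_mod_cast hM)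
  have hexp := fun i => integral_exp_sqrt_mul_sampleDeviation_le hz hindep hident (hf i) (hf01 i) hM
  obtain ⟨S, hS, hle, hbound⟩ := exists_integrable_bound_of_integral_exp_le (Real.exp_pos 1)
    (fun i => (hexp i).1) (fun i => (hexp i).2)
  refine ⟨fun ω => S ω / √M + 2 * ε, (hS.div_const _).add (integrable_const _),
    fun g i hg hg01 hgf ω => ?_, ?_⟩
  · have hnet : sampleDeviation P z M (f i) ω ≤ S ω / √M := by
      rw [le_div_iff₀' hM0]; exact hle i ω
    linarith [sampleDeviation_le_add (hz 0) hM hg (hf i) hg01 (hf01 i) hgf ω (P := P)]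
  · rw [Real.log_mul (by positivity) (by positivity), Real.log_exp] at hbound
    rw [integral_add (hS.div_const _) (integrable_const _), integral_div, integral_const,
      probReal_univ, one_smul]
    gcongr

end Sample

end Deviation

section Risk

lemma abs_sq_sub_sq_le {a b y : ℝ} (ha : a ∈ Set.Icc (0 : ℝ) 1) (hb : b ∈ Set.Icc (0 : ℝ) 1)
    (hy : y ∈ Set.Icc (0 : ℝ) 1) : |(a - y) ^ 2 - (b - y) ^ 2| ≤ 2 * |a - b| := by
  have hsum : |(a - y) + (b - y)| ≤ 2 := by
    rw [abs_le]; constructor <;> linarith [hy.1, hy.2, ha.1, ha.2, hb.1, hb.2]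
  rw [sq_sub_sq, abs_mul, sub_sub_sub_cancel_right]
  gcongr

variable {d D L : ℕ} {l : ℕ → ℕ} {hl0 : l 0 = d}

/-- The squared error `(N_θ(x) - y)²` of a clipped network at a sample `z = (x, y)`. -/
noncomputable def sqLoss (L : ℕ) (l : ℕ → ℕ) (hl0 : l 0 = d) (θ : Fin D → ℝ)
    (z : UnitCube d × unitInterval) : ℝ :=
  (clippedNN L l hl0 θ (z.1 : Fin d → ℝ) - (z.2 : ℝ)) ^ 2

lemma measurable_clippedNN_unitCube (θ : Fin D → ℝ) :
    Measurable fun x : UnitCube d => clippedNN L l hl0 θ (x : Fin d → ℝ) :=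
  ((continuous_clippedNN L l hl0).comp (Continuous.prodMk_right θ)).measurable.comp
    measurable_subtype_coe

lemma measurable_sqLoss (θ : Fin D → ℝ) : Measurable (sqLoss L l hl0 θ) :=
  (((measurable_clippedNN_unitCube θ).comp measurable_fst).sub
    (measurable_subtype_coe.comp measurable_snd)).pow_const 2

lemma sqLoss_mem_Icc (θ : Fin D → ℝ) (z : UnitCube d × unitInterval) :
    sqLoss L l hl0 θ z ∈ Set.Icc (0 : ℝ) 1 :=
  ⟨sq_nonneg _, (sq_le_one_iff_abs_le_one _).2
    (abs_sub_le_one_of_mem_Icc (clippedNN_mem_Icc hl0 θ _) z.2.2)⟩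

lemma empiricalRisk_eq_sum_range (x : ℕ → UnitCube d) (y : ℕ → unitInterval) (J : ℕ)
    (θ : Fin D → ℝ) :
    empiricalRisk L l hl0 x y J θ
      = 1 / (J : ℝ) * ∑ j ∈ Finset.range J, sqLoss L l hl0 θ (x (j + 1), y (j + 1)) := by
  rw [empiricalRisk, ← Finset.Ico_add_one_right_eq_Icc, Finset.sum_Ico_eq_sum_range]
  simp only [sqLoss, sq_abs, Nat.add_sub_cancel, add_comm 1]

lemma exists_norm_sub_gridPoint_le {p N : ℕ} (hN : 0 < N) {c : ℝ} {θ : Fin p → ℝ} (hθ : ‖θ‖ ≤ c) :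
    ∃ g : Fin p → Fin N, ‖θ - fun k => gridPoint (-c) c (g k)‖ ≤ c / N := by
  have hmem : ∀ k, θ k ∈ Set.Icc (-c) c := fun k => abs_le.1 ((norm_le_pi_norm θ k).trans hθ)
  choose g hg using fun k => exists_abs_sub_gridPoint_le hN (hmem k)
  have hc : 0 ≤ c := (norm_nonneg θ).trans hθ
  refine ⟨g, (pi_norm_le_iff_of_nonneg (by positivity)).2 fun k => (hg k).trans_eq ?_⟩
  rw [sub_neg_eq_add, ← two_mul, mul_div_mul_left _ _ two_ne_zero]

variable {Ω : Type*} [MeasurableSpace Ω] {P : Measure Ω} [IsProbabilityMeasure P]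

theorem exists_uniform_risk_deviation_bound (hL : 1 ≤ L) (hlL : l L = 1) {c : ℝ} (hc : 1 ≤ c)
    {z : ℕ → Ω → UnitCube d × unitInterval} (hz : ∀ j, Measurable (z j)) (hindep : iIndepFun z P)
    (hident : ∀ j, IdentDistrib (z j) (z 0) P P) {M N : ℕ} (hM : 1 ≤ M) (hN : 0 < N) :
    ∃ S : Ω → ℝ, Integrable S P ∧
      (∀ ⦃D : ℕ⦄ (θ : Fin D → ℝ), ‖θ‖ ≤ c → ∀ ω,
        sampleDeviation P z M (sqLoss L l hl0 θ) ω ≤ S ω) ∧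
      ∫ ω, S ω ∂P ≤ (numParams l L * Real.log N + 1) / √M
        + 4 * (netLipschitz L l c * (c / N)) := by
  have : Nonempty (Fin N) := ⟨⟨0, hN⟩⟩
  obtain ⟨S, hS, hle, hbound⟩ := exists_uniform_sampleDeviation_bound hz hindep hident
    (f := fun g : Fin (numParams l L) → Fin N => sqLoss L l hl0 fun k => gridPoint (-c) c (g k))
    (fun _ => measurable_sqLoss _) (fun _ => sqLoss_mem_Icc _) hM
    (2 * (netLipschitz L l c * (c / N)))
  refine ⟨S, hS, fun D θ hθ => ?_, hbound.trans_eq ?_⟩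
  · obtain ⟨g, hg⟩ := exists_norm_sub_gridPoint_le hN
      ((norm_leadingParams_le (numParams l L) θ).trans hθ)
    refine hle _ g (measurable_sqLoss θ) (sqLoss_mem_Icc θ) fun b => ?_
    have hgrid : ‖fun k => gridPoint (-c) c (g k)‖ ≤ c :=
      (pi_norm_le_iff_of_nonneg (by linarith)).2 fun k =>
        abs_le.2 (gridPoint_mem_Icc (by linarith) (g k))
    refine (abs_sq_sub_sq_le (clippedNN_mem_Icc hl0 _ _) (clippedNN_mem_Icc hl0 _ _) b.2.2).trans ?_
    have := netLipschitz_nonneg L l (zero_le_one.trans hc)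
    gcongr
    exact (abs_clippedNN_sub_le hL hl0 hlL hc hθ hgrid (norm_le_one_of_unitCube b.1)).trans
      (by gcongr)
  · rw [Fintype.card_pi, Finset.prod_const, Finset.card_univ, Fintype.card_fin, Fintype.card_fin,
      Nat.cast_pow, Real.log_pow]
    ring

end Risk

section BestOf

variable {Ω : Type*} [MeasurableSpace Ω] {P : Measure Ω}

lemma pow_integral_le_integral_pow [IsProbabilityMeasure P] {V : Ω → ℝ} (hV0 : ∀ ω, 0 ≤ V ω)
    {p : ℕ} (hV : Integrable V P) (hVp : Integrable (fun ω => V ω ^ p) P) :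
    (∫ ω, V ω ∂P) ^ p ≤ ∫ ω, V ω ^ p ∂P :=
  (convexOn_pow p).map_integral_le (continuous_pow p).continuousOn isClosed_Ici (.of_forall hV0)
    hV hVp

lemma iInf_mem_Icc {ι : Type*} [Nonempty ι] {f : ι → ℝ} {a b : ℝ}
    (hf : ∀ i, f i ∈ Set.Icc a b) : ⨅ i, f i ∈ Set.Icc a b :=
  ⟨le_ciInf fun i => (hf i).1, (ciInf_le ⟨a, Set.forall_mem_range.2 fun i => (hf i).1⟩
    (Classical.arbitrary ι)).trans (hf _).2⟩

lemma measureReal_lt_iInf_eq_pow {U : ℕ → Ω → ℝ} (hindep : iIndepFun U P)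
    (hident : ∀ k, IdentDistrib (U k) (U 0) P P) {K : ℕ} [Nonempty (Fin K)] (t : ℝ) :
    P.real {ω | t < ⨅ k : Fin K, U k ω} = P.real {ω | t < U 0 ω} ^ K := by
  have hset : {ω | t < ⨅ k : Fin K, U k ω} = ⋂ k ∈ Finset.range K, U k ⁻¹' Set.Ioi t := by
    ext ω
    simp only [Set.mem_ofPred_eq, Set.mem_iInter, Finset.mem_range, Set.mem_preimage, Set.mem_Ioi]
    obtain ⟨m, hm⟩ := exists_eq_ciInf_of_finite (f := fun k : Fin K => U k ω)
    refine ⟨fun h k hk => h.trans_le (ciInf_le (Set.finite_range _).bddBelow (⟨k, hk⟩ : Fin K)),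
      fun h => ?_⟩
    rw [← hm]
    exact h m m.2
  rw [measureReal_def, hset,
    hindep.measure_inter_preimage_eq_mul _ fun _ _ => measurableSet_Ioi, ENNReal.toReal_prod]
  simp only [(hident _).measure_preimage_eq measurableSet_Ioi, Finset.prod_const,
    Finset.card_range]
  rfl

lemma integral_le_inv_of_measureReal_lt_le [IsFiniteMeasure P] {U : Ω → ℝ} (hU : Measurable U)
    (hU01 : ∀ ω, U ω ∈ Set.Icc (0 : ℝ) 1) {K : ℕ}
    (htail : ∀ t ∈ Set.Icc (0 : ℝ) 1, P.real {ω | t < U ω} ≤ (1 - t) ^ K) :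
    ∫ ω, U ω ∂P ≤ 1 / (K + 1) := by
  have hle : ∀ t ∈ Set.Ioi (0 : ℝ), P.real {ω | t < U ω}
      ≤ (Set.Ioc (0 : ℝ) 1).indicator (fun t => (1 - t) ^ K) t := by
    intro t ht
    by_cases h1 : t ≤ 1
    · rw [Set.indicator_of_mem (show t ∈ Set.Ioc 0 1 from ⟨ht, h1⟩)]
      exact htail t ⟨(Set.mem_Ioi.1 ht).le, h1⟩
    · have hempty : {ω | t < U ω} = ∅ :=
        Set.eq_empty_of_forall_notMem fun ω hω => h1 (hω.le.trans (hU01 ω).2)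
      rw [hempty, Set.indicator_of_notMem fun h => h1 h.2, measureReal_empty]
  have hind : Integrable ((Set.Ioc (0 : ℝ) 1).indicator fun t => (1 - t) ^ K) volume :=
    (Continuous.integrableOn_Ioc (by fun_prop)).integrable_indicator measurableSet_Ioc
  calc ∫ ω, U ω ∂P = ∫ t in Set.Ioi (0 : ℝ), P.real {ω | t < U ω} :=
        (Integrable.of_mem_Icc 0 1 hU.aemeasurable (.of_forall hU01)).integral_eq_integral_meas_lt
          (.of_forall fun ω => (hU01 ω).1)
    _ ≤ ∫ t in Set.Ioi (0 : ℝ), (Set.Ioc (0 : ℝ) 1).indicator (fun t => (1 - t) ^ K) t := by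
        refine integral_mono_of_nonneg (.of_forall fun t => measureReal_nonneg) hind.restrict ?_
        filter_upwards [ae_restrict_mem measurableSet_Ioi] with t ht using hle t ht
    _ = ∫ t in (0 : ℝ)..1, (1 - t) ^ K := by
        rw [setIntegral_indicator measurableSet_Ioc, intervalIntegral.integral_of_le zero_le_one,
          Set.inter_eq_self_of_subset_right Set.Ioc_subset_Ioi_self]
    _ = 1 / (K + 1) := by
        rw [intervalIntegral.integral_comp_sub_left (fun t => t ^ K)]
        simp [integral_pow]

variable [IsProbabilityMeasure P]

lemma integral_iInf_le_inv {U : ℕ → Ω → ℝ} (hU : ∀ k, Measurable (U k))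
    (hindep : iIndepFun U P) (hident : ∀ k, IdentDistrib (U k) (U 0) P P)
    (hU01 : ∀ k ω, U k ω ∈ Set.Icc (0 : ℝ) 1)
    (hdistr : ∀ t ∈ Set.Icc (0 : ℝ) 1, t ≤ P.real {ω | U 0 ω ≤ t}) (K : ℕ) [Nonempty (Fin K)] :
    ∫ ω, ⨅ k : Fin K, U k ω ∂P ≤ 1 / (K + 1) := by
  refine integral_le_inv_of_measureReal_lt_le (Measurable.iInf fun k : Fin K => hU k)
    (fun ω => iInf_mem_Icc fun k => hU01 k ω) fun t ht => ?_
  have hcompl : {ω | t < U 0 ω} = {ω | U 0 ω ≤ t}ᶜ := by ext ω; simp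
  rw [measureReal_lt_iInf_eq_pow hindep hident, hcompl,
    probReal_compl_eq_one_sub (measurableSet_le (hU 0) measurable_const)]
  have hle : P.real {ω | U 0 ω ≤ t} ≤ 1 := measureReal_le_one
  gcongr
  exact hdistr t ht

lemma integral_iInf_pow_le_inv {V : ℕ → Ω → ℝ} (hV : ∀ k, Measurable (V k))
    (hindep : iIndepFun V P) (hident : ∀ k, IdentDistrib (V k) (V 0) P P)
    (hV01 : ∀ k ω, V k ω ∈ Set.Icc (0 : ℝ) 1) {p : ℕ} (hp : p ≠ 0)
    (hdistr : ∀ τ ∈ Set.Icc (0 : ℝ) 1, τ ^ p ≤ P.real {ω | V 0 ω ≤ τ})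
    (K : ℕ) [Nonempty (Fin K)] :
    ∫ ω, (⨅ k : Fin K, V k ω) ^ p ∂P ≤ 1 / (K + 1) := by
  have hpow01 : ∀ {v : ℝ}, v ∈ Set.Icc (0 : ℝ) 1 → v ^ p ∈ Set.Icc (0 : ℝ) 1 := fun hv =>
    ⟨pow_nonneg hv.1 p, pow_le_one₀ hv.1 hv.2⟩
  have hinf01 : ∀ ω, ⨅ k : Fin K, V k ω ∈ Set.Icc (0 : ℝ) 1 := fun ω =>
    iInf_mem_Icc fun k => hV01 k ω
  have hmeas : Measurable fun v : ℝ => v ^ p := measurable_id.pow_const p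
  calc ∫ ω, (⨅ k : Fin K, V k ω) ^ p ∂P ≤ ∫ ω, ⨅ k : Fin K, V k ω ^ p ∂P := by
        refine integral_mono
          (.of_mem_Icc 0 1 ((Measurable.iInf fun k : Fin K => hV k).pow_const p).aemeasurable
            (.of_forall fun ω => hpow01 (hinf01 ω)))
          (.of_mem_Icc 0 1 (Measurable.iInf fun k : Fin K => (hV k).pow_const p).aemeasurable
            (.of_forall fun ω => iInf_mem_Icc fun k => hpow01 (hV01 k ω)))
          fun ω => le_ciInf fun k => pow_le_pow_left₀ (hinf01 ω).1 ?_ p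
        exact ciInf_le (Set.finite_range _).bddBelow k
    _ ≤ 1 / (K + 1) := by
        refine integral_iInf_le_inv (fun k => hmeas.comp (hV k)) (hindep.comp _ fun _ => hmeas)
          (fun k => (hident k).comp hmeas) (fun k ω => hpow01 (hV01 k ω)) (fun t ht => ?_) K
        have hroot : (t ^ (p : ℝ)⁻¹) ^ p = t := Real.rpow_inv_natCast_pow ht.1 hp
        have h := hdistr (t ^ (p : ℝ)⁻¹)
          ⟨Real.rpow_nonneg ht.1 _, Real.rpow_le_one ht.1 ht.2 (by positivity)⟩
        rw [hroot] at h
        refine h.trans (measureReal_mono fun ω hω => ?_)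
        rw [Set.mem_ofPred_eq, Function.comp_apply, ← hroot]
        exact pow_le_pow_left₀ (hV01 0 ω).1 hω p

theorem integral_iInf_le_rpow {V : ℕ → Ω → ℝ} (hV : ∀ k, Measurable (V k))
    (hindep : iIndepFun V P) (hident : ∀ k, IdentDistrib (V k) (V 0) P P)
    (hV01 : ∀ k ω, V k ω ∈ Set.Icc (0 : ℝ) 1) {p : ℕ} (hp : p ≠ 0)
    (hdistr : ∀ τ ∈ Set.Icc (0 : ℝ) 1, τ ^ p ≤ P.real {ω | V 0 ω ≤ τ})
    (K : ℕ) [Nonempty (Fin K)] :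
    ∫ ω, ⨅ k : Fin K, V k ω ∂P ≤ (K : ℝ) ^ (-(1 / (p : ℝ))) := by
  have hp0 : (0 : ℝ) < p := by positivity
  have hK : (0 : ℝ) < K := by exact_mod_cast (Classical.arbitrary (Fin K)).pos
  have hinf01 : ∀ ω, ⨅ k : Fin K, V k ω ∈ Set.Icc (0 : ℝ) 1 := fun ω =>
    iInf_mem_Icc fun k => hV01 k ω
  have hinf : Measurable fun ω => ⨅ k : Fin K, V k ω := Measurable.iInf fun k => hV k
  rw [one_div, Real.rpow_neg hK.le, ← Real.inv_rpow hK.le,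
    Real.le_rpow_inv_iff_of_pos (integral_nonneg fun ω => (hinf01 ω).1) (by positivity) hp0,
    Real.rpow_natCast]
  calc (∫ ω, ⨅ k : Fin K, V k ω ∂P) ^ p ≤ ∫ ω, (⨅ k : Fin K, V k ω) ^ p ∂P :=
        pow_integral_le_integral_pow (fun ω => (hinf01 ω).1)
          (.of_mem_Icc 0 1 hinf.aemeasurable (.of_forall hinf01))
          (.of_mem_Icc 0 1 (hinf.pow_const p).aemeasurable
            (.of_forall fun ω =>
              ⟨pow_nonneg (hinf01 ω).1 p, pow_le_one₀ (hinf01 ω).1 (hinf01 ω).2⟩))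
    _ ≤ 1 / (K + 1) := integral_iInf_pow_le_inv hV hindep hident hV01 hp hdistr K
    _ ≤ (K : ℝ)⁻¹ := by
        rw [one_div]
        gcongr
        linarith

end BestOf

section Initialisation

variable {D p : ℕ} {c τ : ℝ}

-- The image of the box under the homothety of ratio `τ` towards `θ₀` in the first `p` coordinates.
lemma exists_Icc_subset_box (hτ : τ ∈ Set.Icc (0 : ℝ) 1) (hp : p ≤ D) {θ₀ : Fin p → ℝ}
    (hθ₀ : ‖θ₀‖ ≤ c) :
    ∃ a b : Fin D → ℝ, (∀ i, b i - a i = 2 * c * if (i : ℕ) < p then τ else 1) ∧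
      Set.Icc a b ⊆ Set.Icc (fun _ => -c) (fun _ => c)
        ∩ {θ | ‖leadingParams p θ - θ₀‖ ≤ 2 * c * τ} := by
  obtain ⟨h0, h1⟩ := hτ
  have hc : 0 ≤ c := (norm_nonneg _).trans hθ₀
  have hparam := fun k => abs_le.1 ((abs_param_le_norm θ₀ k).trans hθ₀)
  set r : ℕ → ℝ := fun i => if i < p then τ else 1
  have hr1 : ∀ i, r i ≤ 1 := fun i => by simp only [r]; split_ifs <;> linarith
  refine ⟨fun i => (1 - r i) * param θ₀ i - c * r i, fun i => (1 - r i) * param θ₀ i + c * r i,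
    fun i => by simp only [r]; ring, fun θ hθ => ⟨⟨fun i => ?_, fun i => ?_⟩, ?_⟩⟩
  · have := hθ.1 i
    simp only at this ⊢
    nlinarith [mul_nonneg (sub_nonneg.2 (hr1 i)) (neg_le_iff_add_nonneg.1 (hparam i).1)]
  · have := hθ.2 i
    simp only at this ⊢
    nlinarith [mul_nonneg (sub_nonneg.2 (hr1 i)) (sub_nonneg.2 (hparam i).2)]
  · refine (pi_norm_le_iff_of_nonneg (by positivity)).2 fun i => ?_
    have hlow := hθ.1 (Fin.castLE hp i)
    have hupp := hθ.2 (Fin.castLE hp i)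
    have hi := hparam i
    have hθ₀i : param θ₀ i = θ₀ i := dif_pos i.2
    have hθi : leadingParams p θ i = θ (Fin.castLE hp i) := dif_pos (i.2.trans_le hp)
    simp only [r, Fin.val_castLE, i.2, if_true, hθ₀i] at hlow hupp hi
    rw [Pi.sub_apply, hθi, Real.norm_eq_abs, abs_le]
    constructor <;> nlinarith

lemma prod_ite_lt_eq_pow (hp : p ≤ D) (τ : ℝ) :
    ∏ i : Fin D, (if (i : ℕ) < p then τ else 1) = τ ^ p := by
  rw [Fin.prod_univ_eq_prod_range (fun i => if i < p then τ else 1), ← Finset.prod_filter,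
    Finset.prod_const, show (Finset.range D).filter (· < p) = Finset.range p by ext; simp; omega,
    Finset.card_range]

variable {Ω : Type*} [MeasurableSpace Ω] {P : Measure Ω}

lemma pow_le_measureReal_norm_leadingParams_sub_le (hc : 0 < c) (hτ : τ ∈ Set.Icc (0 : ℝ) 1)
    (hp : p ≤ D) {θ₀ : Fin p → ℝ} (hθ₀ : ‖θ₀‖ ≤ c) {T : Ω → Fin D → ℝ}
    (hT : pdf.IsUniform T (Set.Icc (fun _ => -c) (fun _ => c)) P volume) :
    τ ^ p ≤ P.real {ω | ‖leadingParams p (T ω) - θ₀‖ ≤ 2 * c * τ} := by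
  set box : Set (Fin D → ℝ) := Set.Icc (fun _ => -c) (fun _ => c)
  set A : Set (Fin D → ℝ) := {θ | ‖leadingParams p θ - θ₀‖ ≤ 2 * c * τ}
  have hA : MeasurableSet A := (isClosed_le
    ((continuous_leadingParams p).sub continuous_const).norm continuous_const).measurableSet
  have hvol : volume.real box = (2 * c) ^ D := by
    rw [measureReal_def, Real.volume_Icc_pi_toReal fun _ => by linarith]
    simp [two_mul]
  have hpos : 0 < volume.real box := hvol ▸ by positivity
  have hfin : volume box ≠ ⊤ := isCompact_Icc.measure_ne_top
  have hP : P.real (T ⁻¹' A) = volume.real (box ∩ A) / volume.real box := by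
    rw [measureReal_def, hT.measure_preimage (ENNReal.toReal_pos_iff.1 hpos).1.ne' hfin hA,
      ENNReal.toReal_div]
    rfl
  obtain ⟨a, b, hab, hsub⟩ := exists_Icc_subset_box hτ hp hθ₀
  have hle : a ≤ b := fun i => sub_nonneg.1 <| by
    rw [hab i]; have := hτ.1; split_ifs <;> positivity
  change τ ^ p ≤ P.real (T ⁻¹' A)
  rw [hP, le_div_iff₀ hpos, hvol]
  calc τ ^ p * (2 * c) ^ D = ∏ i : Fin D, (b i - a i) := by
        rw [Finset.prod_congr rfl fun i _ => hab i, Finset.prod_mul_distrib, prod_ite_lt_eq_pow hp,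
          Finset.prod_const, Finset.card_univ, Fintype.card_fin, mul_comm]
    _ = volume.real (Set.Icc a b) := (Real.volume_Icc_pi_toReal hle).symm
    _ ≤ volume.real (box ∩ A) :=
        measureReal_mono hsub (measure_ne_top_of_subset Set.inter_subset_left hfin)

lemma norm_leadingParams_sub_mem_Icc {θ : Fin D → ℝ} (hθ : ‖θ‖ ≤ c) {θ₀ : Fin p → ℝ}
    (hθ₀ : ‖θ₀‖ ≤ c) : ‖leadingParams p θ - θ₀‖ ∈ Set.Icc 0 (2 * c) :=
  ⟨norm_nonneg _, calc ‖leadingParams p θ - θ₀‖ ≤ ‖leadingParams p θ‖ + ‖θ₀‖ := norm_sub_le _ _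
      _ ≤ c + c := add_le_add ((norm_leadingParams_le p _).trans hθ) hθ₀
      _ = 2 * c := (two_mul c).symm⟩

theorem integral_iInf_norm_leadingParams_sub_le [IsProbabilityMeasure P] (hc : 0 < c)
    (hp0 : p ≠ 0) (hp : p ≤ D) {θ₀ : Fin p → ℝ} (hθ₀ : ‖θ₀‖ ≤ c) {T : ℕ → Ω → Fin D → ℝ}
    (hT : ∀ k, Measurable (T k)) (hTc : ∀ k ω, ‖T k ω‖ ≤ c) (hindep : iIndepFun T P)
    (hident : ∀ k, IdentDistrib (T k) (T 0) P P)
    (hunif : pdf.IsUniform (T 0) (Set.Icc (fun _ => -c) (fun _ => c)) P volume)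
    (K : ℕ) [Nonempty (Fin K)] :
    ∫ ω, ⨅ k : Fin K, ‖leadingParams p (T k ω) - θ₀‖ ∂P
      ≤ 2 * c * (K : ℝ) ^ (-(1 / (p : ℝ))) := by
  have h2c : 0 < 2 * c := by positivity
  have hmeas : Measurable fun θ : Fin D → ℝ => ‖leadingParams p θ - θ₀‖ / (2 * c) :=
    ((continuous_leadingParams p).sub continuous_const).norm.measurable.div_const _
  have h := integral_iInf_le_rpow (fun k => hmeas.comp (hT k)) (hindep.comp _ fun _ => hmeas)
    (fun k => (hident k).comp hmeas)
    (fun k ω => ⟨by simp only [Function.comp_apply]; positivity, (div_le_one h2c).2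
      (norm_leadingParams_sub_mem_Icc (hTc k ω) hθ₀).2⟩)
    hp0 (fun τ hτ => by
      simpa only [Function.comp_apply, div_le_iff₀' h2c]
        using pow_le_measureReal_norm_leadingParams_sub_le hc hτ hp hθ₀ hunif) K
  simp only [Function.comp_apply, div_eq_mul_inv,
    ← Real.iInf_mul_of_nonneg (inv_nonneg.2 h2c.le), integral_mul_const] at h
  rwa [← div_eq_mul_inv, div_le_iff₀' h2c] at h

end Initialisation

section BiasVariance

variable {Ω : Type*} {m mΩ : MeasurableSpace Ω} {P : Measure Ω} [IsFiniteMeasure P]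

lemma integral_mul_condExp (hm : m ≤ mΩ) {g Y : Ω → ℝ} (hg : StronglyMeasurable[m] g)
    (hgY : Integrable (g * Y) P) (hY : Integrable Y P) :
    ∫ ω, g ω * (P[Y | m]) ω ∂P = ∫ ω, g ω * Y ω ∂P := by
  calc ∫ ω, g ω * (P[Y | m]) ω ∂P = ∫ ω, (P[g * Y | m]) ω ∂P :=
        (integral_congr_ae (condExp_mul_of_stronglyMeasurable_left hg hgY hY)).symm
    _ = ∫ ω, g ω * Y ω ∂P := integral_condExp hm

lemma integral_sq_sub_eq_add (hm : m ≤ mΩ) {h Y : Ω → ℝ} (hh : StronglyMeasurable[m] h)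
    (hh2 : MemLp h 2 P) (hY : MemLp Y 2 P) :
    ∫ ω, (h ω - Y ω) ^ 2 ∂P
      = ∫ ω, (h ω - (P[Y | m]) ω) ^ 2 ∂P + ∫ ω, ((P[Y | m]) ω - Y ω) ^ 2 ∂P := by
  set C := P[Y | m]
  have hC : MemLp C 2 P := hY.condExp one_le_two
  have hg : MemLp (h - C) 2 P := hh2.sub hC
  have hgC : Integrable (fun ω => (h ω - C ω) * C ω) P := hg.integrable_mul hC
  have hgY : Integrable (fun ω => (h ω - C ω) * Y ω) P := hg.integrable_mul hY
  have hgC2 : Integrable (fun ω => (h ω - C ω) ^ 2) P := hg.integrable_sq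
  have hCY2 : Integrable (fun ω => (C ω - Y ω) ^ 2) P := (hC.sub hY).integrable_sq
  have horth : ∫ ω, (h ω - C ω) * C ω ∂P = ∫ ω, (h ω - C ω) * Y ω ∂P :=
    integral_mul_condExp hm (hh.sub stronglyMeasurable_condExp) hgY (hY.integrable one_le_two)
  calc ∫ ω, (h ω - Y ω) ^ 2 ∂P
      = ∫ ω, ((h ω - C ω) ^ 2 + (C ω - Y ω) ^ 2
          + 2 * ((h ω - C ω) * C ω - (h ω - C ω) * Y ω)) ∂P := by
        congr with ω; ring
    _ = ∫ ω, (h ω - C ω) ^ 2 ∂P + ∫ ω, (C ω - Y ω) ^ 2 ∂P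
          + 2 * (∫ ω, (h ω - C ω) * C ω ∂P - ∫ ω, (h ω - C ω) * Y ω ∂P) := by
        rw [← integral_sub hgC hgY, ← integral_const_mul, ← integral_add hgC2 hCY2]
        exact integral_add (hgC2.add hCY2) ((hgC.sub hgY).const_mul 2)
    _ = ∫ ω, (h ω - C ω) ^ 2 ∂P + ∫ ω, (C ω - Y ω) ^ 2 ∂P := by rw [horth]; ring

end BiasVariance

section ExcessRisk

variable {Ω α : Type*} [MeasurableSpace Ω] [MeasurableSpace α] {P : Measure Ω}
  [IsProbabilityMeasure P] {X : Ω → α} {Y : Ω → ℝ} {e f f₁ : α → ℝ}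

lemma integral_sq_regression_add (hX : Measurable X) (hY : MemLp Y 2 P) (hf : Measurable f)
    (hf01 : ∀ x, f x ∈ Set.Icc (0 : ℝ) 1)
    (hcond : (fun ω => e (X ω)) =ᵐ[P] P[Y | MeasurableSpace.comap X inferInstance]) :
    ∫ ω, (f (X ω) - Y ω) ^ 2 ∂P
      = ∫ ω, (f (X ω) - e (X ω)) ^ 2 ∂P + ∫ ω, (e (X ω) - Y ω) ^ 2 ∂P := by
  have hfX : MemLp (fun ω => f (X ω)) 2 P :=
    memLp_of_bounded (.of_forall fun ω => hf01 (X ω)) (hf.comp hX).aestronglyMeasurable 2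
  rw [integral_sq_sub_eq_add hX.comap_le (h := fun ω => f (X ω))
    (hf.comp (comap_measurable X)).stronglyMeasurable hfX hY]
  congr 1 <;> refine integral_congr_ae ?_ <;> filter_upwards [hcond] with ω hω <;> rw [hω]

theorem integral_abs_sub_le_add_sqrt (hX : Measurable X) (hY : MemLp Y 2 P)
    (he : Measurable e) (he01 : ∀ x, e x ∈ Set.Icc (0 : ℝ) 1)
    (hf : Measurable f) (hf01 : ∀ x, f x ∈ Set.Icc (0 : ℝ) 1)
    (hf₁ : Measurable f₁) (hf₁01 : ∀ x, f₁ x ∈ Set.Icc (0 : ℝ) 1)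
    (hcond : (fun ω => e (X ω)) =ᵐ[P] P[Y | MeasurableSpace.comap X inferInstance])
    {u s : ℝ} (hu : 0 ≤ u) (hs : 0 ≤ s) (happrox : ∀ x, |f₁ x - e x| ≤ u)
    (hrisk : ∫ ω, (f (X ω) - Y ω) ^ 2 ∂P ≤ ∫ ω, (f₁ (X ω) - Y ω) ^ 2 ∂P + s) :
    ∫ x, |f x - e x| ∂(P.map X) ≤ u + √s := by
  have hfe : Measurable fun x => |f x - e x| := (hf.sub he).abs
  have hfe01 : ∀ x, |f x - e x| ∈ Set.Icc (0 : ℝ) 1 := fun x =>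
    ⟨abs_nonneg _, abs_sub_le_one_of_mem_Icc (hf01 x) (he01 x)⟩
  have happrox2 : ∫ ω, (f₁ (X ω) - e (X ω)) ^ 2 ∂P ≤ u ^ 2 := by
    calc ∫ ω, (f₁ (X ω) - e (X ω)) ^ 2 ∂P ≤ ∫ _, u ^ 2 ∂P :=
          integral_mono_of_nonneg (.of_forall fun _ => sq_nonneg _) (integrable_const _)
            (.of_forall fun ω => sq_le_sq.2 ((happrox (X ω)).trans (le_abs_self u)))
      _ = u ^ 2 := by simp
  rw [integral_map hX.aemeasurable hfe.aestronglyMeasurable]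
  refine le_of_sq_le_sq ?_ (by positivity)
  calc (∫ ω, |f (X ω) - e (X ω)| ∂P) ^ 2 ≤ ∫ ω, |f (X ω) - e (X ω)| ^ 2 ∂P :=
        pow_integral_le_integral_pow (fun _ => abs_nonneg _)
          (integrable_comp_of_mem_Icc (f := fun x => |f x - e x|) hX hfe hfe01)
          (integrable_comp_of_mem_Icc (f := fun x => |f x - e x| ^ 2) hX (hfe.pow_const 2)
            fun x => ⟨by positivity, pow_le_one₀ (hfe01 x).1 (hfe01 x).2⟩)
    _ = ∫ ω, (f (X ω) - e (X ω)) ^ 2 ∂P := by simp only [sq_abs]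
    _ ≤ ∫ ω, (f₁ (X ω) - e (X ω)) ^ 2 ∂P + s := by
        rw [integral_sq_regression_add hX hY hf hf01 hcond,
          integral_sq_regression_add hX hY hf₁ hf₁01 hcond] at hrisk
        linarith
    _ ≤ (u + √s) ^ 2 := by nlinarith [Real.sq_sqrt hs, Real.sqrt_nonneg s]

end ExcessRisk

section Rates

variable {L : ℕ} {l : ℕ → ℕ} {c : ℝ}

lemma netLipschitz_mul_le (hL : 1 ≤ L) (hc : 2 ≤ c) :
    2 * (netLipschitz L l c * c) ≤ (c ^ 3 * L * (maxWidth L l + 1)) ^ L := by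
  have hL1 : (1 : ℝ) ≤ L := by exact_mod_cast hL
  have hc1 : 1 ≤ c := by linarith
  calc 2 * (netLipschitz L l c * c) = 2 * c ^ L * L * (maxWidth L l + 1) ^ L := by
        rw [netLipschitz, mul_assoc _ _ c, pow_sub_one_mul (by omega)]; ring
    _ ≤ (c ^ L * c ^ L) * L ^ L * (maxWidth L l + 1) ^ L := by
        gcongr
        · exact hc.trans (le_self_pow₀ hc1 (by omega))
        · exact le_self_pow₀ hL1 (by omega)
    _ = (c ^ 2 * L * (maxWidth L l + 1)) ^ L := by
        rw [← pow_add, ← two_mul, pow_mul, ← mul_pow, ← mul_pow]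
    _ ≤ (c ^ 3 * L * (maxWidth L l + 1)) ^ L := by gcongr; norm_num

lemma one_le_netLipschitz_mul (hL : 1 ≤ L) (hc : 1 ≤ c) : 1 ≤ netLipschitz L l c * c := by
  have hL1 : (1 : ℝ) ≤ L := by exact_mod_cast hL
  have hW : (1 : ℝ) ≤ maxWidth L l + 1 := by linarith [(maxWidth L l).cast_nonneg (α := ℝ)]
  unfold netLipschitz
  refine one_le_mul_of_one_le_of_one_le (one_le_mul_of_one_le_of_one_le
    (one_le_mul_of_one_le_of_one_le hL1 (one_le_pow₀ hW)) (one_le_pow₀ hc)) hc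

lemma natCeil_netLipschitz_mul_le_pow (hL : 1 ≤ L) (hc : 2 ≤ c) {M : ℕ} (hM : 1 ≤ M)
    (hlarge : c ^ 3 * L * (maxWidth L l + 1) ≤ √M) :
    (⌈netLipschitz L l c * c * √M⌉₊ : ℝ) ≤ (M : ℝ) ^ L := by
  have hs : 1 ≤ √(M : ℝ) := Real.one_le_sqrt.2 (by exact_mod_cast hM)
  have hone : 1 ≤ netLipschitz L l c * c * √M :=
    one_le_mul_of_one_le_of_one_le (one_le_netLipschitz_mul hL (by linarith)) hs
  calc (⌈netLipschitz L l c * c * √M⌉₊ : ℝ) ≤ 2 * (netLipschitz L l c * c * √M) := by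
        linarith [Nat.ceil_lt_add_one (zero_le_one.trans hone)]
    _ = 2 * (netLipschitz L l c * c) * √M := by ring
    _ ≤ √M ^ L * √M ^ L := by
        gcongr
        · exact (netLipschitz_mul_le hL hc).trans (by gcongr)
        · exact le_self_pow₀ hs (by omega)
    _ = (M : ℝ) ^ L := by rw [← mul_pow, Real.mul_self_sqrt (Nat.cast_nonneg M)]

lemma numParams_mul_log_le (hL : 1 ≤ L) (hc : 2 ≤ c) {M : ℕ} (hM : 1 ≤ M)
    (hlarge : c ^ 3 * L * (maxWidth L l + 1) ≤ √M) :
    numParams l L * Real.log ⌈netLipschitz L l c * c * √M⌉₊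
      ≤ (L * (maxWidth L l + 1)) ^ 2 * Real.log M := by
  have hN := natCeil_netLipschitz_mul_le_pow hL hc hM hlarge
  have hp : (numParams l L : ℝ) ≤ L * (maxWidth L l + 1) ^ 2 := by exact_mod_cast numParams_le L l
  have hM1 : (1 : ℝ) ≤ M := by exact_mod_cast hM
  have hceil : (0 : ℝ) < ⌈netLipschitz L l c * c * √M⌉₊ := by
    have := one_le_netLipschitz_mul (l := l) hL (by linarith : 1 ≤ c)
    exact_mod_cast Nat.ceil_pos.2 (by positivity)
  calc numParams l L * Real.log ⌈netLipschitz L l c * c * √M⌉₊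
      ≤ numParams l L * Real.log ((M : ℝ) ^ L) := by gcongr
    _ = numParams l L * (L * Real.log M) := by rw [Real.log_pow]
    _ ≤ L * (maxWidth L l + 1) ^ 2 * (L * Real.log M) := by
        have := Real.log_nonneg hM1
        gcongr
    _ = (L * (maxWidth L l + 1)) ^ 2 * Real.log M := by ring

lemma log_exp_one_mul {M : ℕ} (hM : 1 ≤ M) :
    Real.log (Real.exp 1 * M) = 1 + Real.log M := by
  rw [Real.log_mul (Real.exp_pos 1).ne' (by positivity), Real.log_exp]

lemma log_exp_one_mul_pos {M : ℕ} (hM : 1 ≤ M) : 0 < Real.log (Real.exp 1 * M) := by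
  rw [log_exp_one_mul hM]
  linarith [Real.log_nonneg (Nat.one_le_cast.2 hM : (1 : ℝ) ≤ M)]

lemma le_sqrt_of_mul_log_div_rpow_lt_one {a : ℝ} (ha : 0 ≤ a) {M : ℕ} (hM : 1 ≤ M)
    (hlt : a * Real.log (Real.exp 1 * M) / (M : ℝ) ^ (1 / 4 : ℝ) < 1) : a ≤ √M := by
  have hM1 : (1 : ℝ) ≤ M := by exact_mod_cast hM
  calc a ≤ a * Real.log (Real.exp 1 * M) := by
        refine le_mul_of_one_le_right ha ?_
        linarith [log_exp_one_mul hM, Real.log_nonneg hM1]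
    _ ≤ (M : ℝ) ^ (1 / 4 : ℝ) := ((div_lt_one (by positivity)).1 hlt).le
    _ ≤ √M := by
        rw [Real.sqrt_eq_rpow]
        exact Real.rpow_le_rpow_of_exponent_le hM1 (by norm_num)

lemma two_mul_sq_mul_add_ten_le {q x : ℝ} (hc : 2 ≤ c) (hq : 2 ≤ q) (hx : 0 ≤ x) :
    2 * (q ^ 2 * x + 5) ≤ (c ^ 3 * q * (1 + x)) ^ 2 := by
  have hq4 : 2 ^ 2 ≤ q ^ 2 := by gcongr
  have hc3 : 2 ^ 3 ≤ c ^ 3 := by gcongr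
  calc 2 * (q ^ 2 * x + 5) ≤ (2 ^ 3) ^ 2 * q ^ 2 * (1 + x) := by nlinarith
    _ ≤ (c ^ 3) ^ 2 * q ^ 2 * (1 + x) ^ 2 := by
        gcongr
        exact le_self_pow₀ (by linarith) two_ne_zero
    _ = (c ^ 3 * q * (1 + x)) ^ 2 := by ring

lemma exists_mesh (hL : 1 ≤ L) (hc : 2 ≤ c) {M : ℕ} (hM : 1 ≤ M) (hW : 1 ≤ maxWidth L l)
    (hlt : c ^ 3 * L * (maxWidth L l + 1) * Real.log (Real.exp 1 * M) / (M : ℝ) ^ (1 / 4 : ℝ) < 1) :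
    ∃ N : ℕ, 0 < N ∧
      2 * ((numParams l L * Real.log N + 1) / √M + 4 * (netLipschitz L l c * (c / N)))
        ≤ (c ^ 3 * L * (maxWidth L l + 1) * Real.log (Real.exp 1 * M)
          / (M : ℝ) ^ (1 / 4 : ℝ)) ^ 2 := by
  have hM1 : (1 : ℝ) ≤ M := by exact_mod_cast hM
  have hs0 : 0 < √(M : ℝ) := Real.sqrt_pos.2 (by linarith)
  have hLW : (2 : ℝ) ≤ L * (maxWidth L l + 1) := by
    exact_mod_cast Nat.mul_le_mul hL (Nat.succ_le_succ hW)
  have hentropy := numParams_mul_log_le hL hc hM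
    (le_sqrt_of_mul_log_div_rpow_lt_one (by positivity) hM hlt)
  have hone := one_le_netLipschitz_mul (l := l) hL (by linarith : 1 ≤ c)
  have hN : 0 < ⌈netLipschitz L l c * c * √M⌉₊ := Nat.ceil_pos.2 (by positivity)
  have hmesh : netLipschitz L l c * (c / ⌈netLipschitz L l c * c * √M⌉₊) ≤ 1 / √M := by
    rw [← mul_div_assoc, div_le_div_iff₀ (by exact_mod_cast hN) hs0, one_mul]
    exact Nat.le_ceil _
  have hsq : ((M : ℝ) ^ (1 / 4 : ℝ)) ^ 2 = √M := by
    rw [← Real.rpow_natCast, ← Real.rpow_mul (by positivity), Real.sqrt_eq_rpow]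
    norm_num
  refine ⟨_, hN, ?_⟩
  rw [div_pow, hsq, log_exp_one_mul hM, mul_assoc (c ^ 3)]
  calc _ ≤ 2 * (((L * (maxWidth L l + 1)) ^ 2 * Real.log M + 1) / √M + 4 * (1 / √M)) := by gcongr
    _ = 2 * ((L * (maxWidth L l + 1)) ^ 2 * Real.log M + 5) / √M := by ring
    _ ≤ _ := by
        gcongr
        exact two_mul_sq_mul_add_ten_le hc hLW (Real.log_nonneg hM1)

lemma netLipschitz_mul_rpow_le (hL : 1 ≤ L) (hc : 2 ≤ c) (hp : numParams l L ≠ 0) {K : ℕ}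
    (hK : 1 ≤ K) :
    netLipschitz L l c * (2 * c * (K : ℝ) ^ (-(1 / (numParams l L : ℝ))))
      ≤ L * (maxWidth L l + 1) ^ L * c ^ (L + 1)
        / (K : ℝ) ^ ((2 * (L : ℝ))⁻¹ * (((maxWidth L l : ℝ) + 1) ^ 2)⁻¹) := by
  have hL1 : (1 : ℝ) ≤ L := by exact_mod_cast hL
  have hK1 : (1 : ℝ) ≤ K := by exact_mod_cast hK
  have hexp : (2 * (L : ℝ))⁻¹ * (((maxWidth L l : ℝ) + 1) ^ 2)⁻¹ ≤ 1 / (numParams l L : ℝ) := by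
    have hple : (numParams l L : ℝ) ≤ L * (maxWidth L l + 1) ^ 2 := by
      exact_mod_cast numParams_le L l
    rw [one_div, ← mul_inv]
    gcongr
    nlinarith [mul_nonneg (zero_le_one.trans hL1) (sq_nonneg ((maxWidth L l : ℝ) + 1))]
  calc netLipschitz L l c * (2 * c * (K : ℝ) ^ (-(1 / (numParams l L : ℝ))))
      = L * (maxWidth L l + 1) ^ L * (2 * c ^ L) * (K : ℝ) ^ (-(1 / (numParams l L : ℝ))) := by
        rw [netLipschitz, ← pow_sub_one_mul (by omega : L ≠ 0) c]; ring
    _ ≤ L * (maxWidth L l + 1) ^ L * (c * c ^ L)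
          * (K : ℝ) ^ (-((2 * (L : ℝ))⁻¹ * (((maxWidth L l : ℝ) + 1) ^ 2)⁻¹)) := by
        gcongr
    _ = _ := by rw [Real.rpow_neg (by positivity), ← pow_succ', ← div_eq_mul_inv]

end Rates

section Training

variable {d D L : ℕ} {l : ℕ → ℕ} {hl0 : l 0 = d} {c : ℝ} {E : UnitCube d → unitInterval}
  {Ω : Type*} [MeasurableSpace Ω]

lemma measurable_of_lipschitz_unitCube (hc : 0 ≤ c)
    (hE : ∀ x y : UnitCube d,
      |(E x : ℝ) - (E y : ℝ)| ≤ c * ∑ i, |(x : Fin d → ℝ) i - (y : Fin d → ℝ) i|) :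
    Measurable fun x => (E x : ℝ) := by
  refine (LipschitzWith.of_dist_le_mul (K := ⟨c * d, by positivity⟩)
    fun x y => ?_).continuous.measurable
  calc dist (E x : ℝ) (E y) ≤ c * ∑ i, dist ((x : Fin d → ℝ) i) ((y : Fin d → ℝ) i) := hE x y
    _ ≤ c * ∑ _i : Fin d, dist x y := by
        gcongr
        exact dist_le_pi_dist (x : Fin d → ℝ) (y : Fin d → ℝ) _
    _ = c * d * dist x y := by simp [mul_assoc]

lemma measurable_random_index {ι β : Type*} [Countable ι] [MeasurableSpace ι]
    [MeasurableSingletonClass ι] [MeasurableSpace β] {Z : ι → Ω → β} (hZ : ∀ i, Measurable (Z i))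
    {k : Ω → ι} (hk : Measurable k) : Measurable fun ω => Z (k ω) ω :=
  (measurable_from_prod_countable_right (f := fun q : ι × Ω => Z q.1 q.2) hZ).comp
    (hk.prodMk measurable_id)

lemma measurable_abs_clippedNN_sub {θ : Ω → Fin D → ℝ} (hθ : Measurable θ)
    (hE : Measurable fun x => (E x : ℝ)) :
    Measurable fun p : Ω × UnitCube d =>
      |clippedNN L l hl0 (θ p.1) (p.2 : Fin d → ℝ) - (E p.2 : ℝ)| :=
  (((continuous_clippedNN L l hl0).measurable.comp ((hθ.comp measurable_fst).prodMk
    (measurable_subtype_coe.comp measurable_snd))).sub (hE.comp measurable_snd)).abs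

lemma norm_le_of_mem_box {θ : Fin D → ℝ} (hc : 0 ≤ c)
    (hθ : θ ∈ Set.Icc (fun _ => -c) (fun _ => c)) : ‖θ‖ ≤ c :=
  (pi_norm_le_iff_of_nonneg hc).2 fun i => abs_le.2 ⟨hθ.1 i, hθ.2 i⟩

lemma integral_le_of_forall_mem_Icc {μ : Measure Ω} [IsProbabilityMeasure μ] {F : Ω → ℝ} {C : ℝ}
    (hF : ∀ ω, F ω ∈ Set.Icc 0 C) : ∫ ω, F ω ∂μ ≤ C := by
  simpa using integral_mono_of_nonneg (.of_forall fun ω => (hF ω).1) (integrable_const (μ := μ) C)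
    (.of_forall fun ω => (hF ω).2)

lemma abs_clippedNN_sub_mem_Icc (θ : Fin D → ℝ) (x : UnitCube d) :
    |clippedNN L l hl0 θ (x : Fin d → ℝ) - (E x : ℝ)| ∈ Set.Icc (0 : ℝ) 1 :=
  ⟨abs_nonneg _, abs_sub_le_one_of_mem_Icc (clippedNN_mem_Icc hl0 θ _) (E x).2⟩

lemma sqrt_two_mul_le {b s : ℝ} (hb : 0 < b) (hs : 0 ≤ s) : √(2 * s) ≤ b / 2 + s / b := by
  refine Real.sqrt_le_iff.2 ⟨by positivity, ?_⟩
  have hdiff : (b / 2 + s / b) ^ 2 = 2 * s + (b / 2 - s / b) ^ 2 := by field_simp; ring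
  rw [hdiff]
  exact le_add_of_nonneg_right (sq_nonneg _)

variable {P : Measure Ω} {X : ℕ → Ω → UnitCube d} {Y : ℕ → Ω → unitInterval} {M : ℕ}

lemma exists_risk_deviation_bound_sq [IsProbabilityMeasure P] (hL : 1 ≤ L) (hlL : l L = 1)
    (hc : 2 ≤ c) {z : ℕ → Ω → UnitCube d × unitInterval} (hz : ∀ j, Measurable (z j))
    (hindep : iIndepFun z P) (hident : ∀ j, IdentDistrib (z j) (z 0) P P) (hM : 1 ≤ M)
    (hlt : c ^ 3 * L * (maxWidth L l + 1) * Real.log (Real.exp 1 * M) / (M : ℝ) ^ (1 / 4 : ℝ) < 1) :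
    ∃ S : Ω → ℝ, Integrable S P ∧
      (∀ ⦃D : ℕ⦄ (θ : Fin D → ℝ), ‖θ‖ ≤ c → ∀ ω,
        sampleDeviation P z M (sqLoss L l hl0 θ) ω ≤ S ω) ∧
      2 * ∫ ω, S ω ∂P ≤ (c ^ 3 * L * (maxWidth L l + 1) * Real.log (Real.exp 1 * M)
        / (M : ℝ) ^ (1 / 4 : ℝ)) ^ 2 := by
  obtain ⟨N, hN, hNb⟩ := exists_mesh hL hc hM (hlL.symm.le.trans (le_maxWidth l le_rfl)) hlt
  obtain ⟨S, hS, hdev, hSb⟩ := exists_uniform_risk_deviation_bound (hl0 := hl0) hL hlL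
    (one_le_two.trans hc) hz hindep hident hM hN
  exact ⟨S, hS, hdev, (mul_le_mul_of_nonneg_left hSb zero_le_two).trans hNb⟩

lemma integral_sqLoss_le_add {θ θ' : Fin D → ℝ} {s : ℝ} {ω : Ω}
    (hθ : sampleDeviation P (fun j ω => (X (j + 1) ω, Y (j + 1) ω)) M (sqLoss L l hl0 θ) ω ≤ s)
    (hθ' : sampleDeviation P (fun j ω => (X (j + 1) ω, Y (j + 1) ω)) M (sqLoss L l hl0 θ') ω ≤ s)
    (hemp : empiricalRisk L l hl0 (fun j => X j ω) (fun j => Y j ω) M θ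
      ≤ empiricalRisk L l hl0 (fun j => X j ω) (fun j => Y j ω) M θ') :
    ∫ ω, sqLoss L l hl0 θ (X 1 ω, Y 1 ω) ∂P
      ≤ ∫ ω, sqLoss L l hl0 θ' (X 1 ω, Y 1 ω) ∂P + 2 * s := by
  rw [empiricalRisk_eq_sum_range, empiricalRisk_eq_sum_range] at hemp
  simp only [sampleDeviation, abs_le, zero_add] at hθ hθ'
  linarith

variable [IsProbabilityMeasure P]

theorem integral_abs_clippedNN_sub_le (hX : Measurable (X 1)) (hY : Measurable (Y 1))
    (hEm : Measurable fun x => (E x : ℝ))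
    (hE : (fun ω => (E (X 1 ω) : ℝ)) =ᵐ[P]
      P[fun ω => (Y 1 ω : ℝ) | MeasurableSpace.comap (X 1) inferInstance])
    (hL : 1 ≤ L) (hlL : l L = 1) (hc : 1 ≤ c) {θ₀ : Fin (numParams l L) → ℝ} (hθ₀ : ‖θ₀‖ ≤ c)
    {a : ℝ} (happrox : ∀ x : UnitCube d, |clippedNN L l hl0 θ₀ (x : Fin d → ℝ) - E x| ≤ a)
    {θ θ' : Fin D → ℝ} (hθ : ‖θ‖ ≤ c) (hθ' : ‖θ'‖ ≤ c) {s : ℝ} {ω : Ω}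
    (hdev : ∀ θ : Fin D → ℝ, ‖θ‖ ≤ c →
      sampleDeviation P (fun j ω => (X (j + 1) ω, Y (j + 1) ω)) M (sqLoss L l hl0 θ) ω ≤ s)
    (hemp : empiricalRisk L l hl0 (fun j => X j ω) (fun j => Y j ω) M θ
      ≤ empiricalRisk L l hl0 (fun j => X j ω) (fun j => Y j ω) M θ') :
    ∫ x, |clippedNN L l hl0 θ (x : Fin d → ℝ) - (E x : ℝ)| ∂(P.map (X 1))
      ≤ a + netLipschitz L l c * ‖leadingParams (numParams l L) θ' - θ₀‖ + √(2 * s) := by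
  have ha : 0 ≤ a := (abs_nonneg _).trans (happrox (X 1 ω))
  have hs : 0 ≤ s := (abs_nonneg _).trans (hdev θ hθ)
  have hΛ := netLipschitz_nonneg L l (zero_le_one.trans hc)
  have happrox' : ∀ x : UnitCube d, |clippedNN L l hl0 θ' (x : Fin d → ℝ) - E x|
      ≤ a + netLipschitz L l c * ‖leadingParams (numParams l L) θ' - θ₀‖ := fun x =>
    calc _ ≤ |clippedNN L l hl0 θ' (x : Fin d → ℝ) - clippedNN L l hl0 θ₀ (x : Fin d → ℝ)|
          + |clippedNN L l hl0 θ₀ (x : Fin d → ℝ) - E x| := abs_sub_le _ _ _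
      _ ≤ _ := by
        rw [add_comm a]
        exact add_le_add (abs_clippedNN_sub_le hL hl0 hlL hc hθ' hθ₀ (norm_le_one_of_unitCube x))
          (happrox x)
  exact integral_abs_sub_le_add_sqrt hX
    (memLp_of_bounded (.of_forall fun ω => (Y 1 ω).2)
      (measurable_subtype_coe.comp hY).aestronglyMeasurable 2)
    hEm (fun x => (E x).2)
    (measurable_clippedNN_unitCube θ) (fun x => clippedNN_mem_Icc hl0 θ _)
    (measurable_clippedNN_unitCube θ') (fun x => clippedNN_mem_Icc hl0 θ' _)
    hE (by positivity) (by positivity) happrox'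
    (integral_sqLoss_le_add (hdev θ hθ) (hdev θ' hθ') hemp)

lemma integral_le_of_forall_le_add_sqrt {F V S : Ω → ℝ} {a b Λ : ℝ} (hF : ∀ ω, 0 ≤ F ω)
    (hV : Integrable V P) (hS : Integrable S P) (hS0 : ∀ ω, 0 ≤ S ω) (hb : 0 < b)
    (hSb : 2 * ∫ ω, S ω ∂P ≤ b ^ 2) (hFle : ∀ ω, F ω ≤ a + Λ * V ω + √(2 * S ω)) :
    ∫ ω, F ω ∂P ≤ a + b + Λ * ∫ ω, V ω ∂P := by
  have hVS : Integrable (fun ω => Λ * V ω + S ω / b) P := (hV.const_mul Λ).add (hS.div_const b)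
  calc ∫ ω, F ω ∂P ≤ ∫ ω, ((a + b / 2) + (Λ * V ω + S ω / b)) ∂P :=
        integral_mono_of_nonneg (.of_forall hF) ((integrable_const _).add hVS)
          (.of_forall fun ω => by linarith [hFle ω, sqrt_two_mul_le hb (hS0 ω)])
    _ = a + b / 2 + (Λ * ∫ ω, V ω ∂P + (∫ ω, S ω ∂P) / b) := by
        rw [integral_add (integrable_const _) hVS,
          integral_add (hV.const_mul Λ) (hS.div_const b), integral_const_mul, integral_div]
        simp
    _ ≤ a + b + Λ * ∫ ω, V ω ∂P := by
        have : (∫ ω, S ω ∂P) / b ≤ b / 2 := by rw [div_le_iff₀ hb]; linarith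
        linarith

theorem integral_integral_abs_clippedNN_sub_le (hX : Measurable (X 1)) (hY : Measurable (Y 1))
    (hEm : Measurable fun x => (E x : ℝ))
    (hE : (fun ω => (E (X 1 ω) : ℝ)) =ᵐ[P]
      P[fun ω => (Y 1 ω : ℝ) | MeasurableSpace.comap (X 1) inferInstance])
    (hL : 1 ≤ L) (hlL : l L = 1) (hc : 1 ≤ c) {θ₀ : Fin (numParams l L) → ℝ} (hθ₀ : ‖θ₀‖ ≤ c)
    {a : ℝ} (happrox : ∀ x : UnitCube d, |clippedNN L l hl0 θ₀ (x : Fin d → ℝ) - E x| ≤ a)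
    {S : Ω → ℝ} (hS : Integrable S P)
    (hdev : ∀ θ : Fin D → ℝ, ‖θ‖ ≤ c → ∀ ω,
      sampleDeviation P (fun j ω => (X (j + 1) ω, Y (j + 1) ω)) M (sqLoss L l hl0 θ) ω ≤ S ω)
    {b : ℝ} (hb : 0 < b) (hSb : 2 * ∫ ω, S ω ∂P ≤ b ^ 2) (hp0 : numParams l L ≠ 0)
    (hparams : numParams l L ≤ D) {T : ℕ → Ω → Fin D → ℝ} (hT : ∀ k, Measurable (T k))
    (hTc : ∀ k ω, ‖T k ω‖ ≤ c) (hTindep : iIndepFun T P)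
    (hTident : ∀ k, IdentDistrib (T k) (T 0) P P)
    (hTunif : pdf.IsUniform (T 0) (Set.Icc (fun _ => -c) (fun _ => c)) P volume)
    {ϑ : Ω → Fin D → ℝ} (hϑc : ∀ ω, ‖ϑ ω‖ ≤ c) {K : ℕ} (hK : 1 ≤ K)
    (hϑT : ∀ ω, ∀ k < K,
      empiricalRisk L l hl0 (fun j => X j ω) (fun j => Y j ω) M (ϑ ω)
        ≤ empiricalRisk L l hl0 (fun j => X j ω) (fun j => Y j ω) M (T k ω)) :
    ∫ ω, (∫ x : UnitCube d, |clippedNN L l hl0 (ϑ ω) (x : Fin d → ℝ) - (E x : ℝ)|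
        ∂(P.map (X 1))) ∂P
      ≤ a + b + netLipschitz L l c * (2 * c * (K : ℝ) ^ (-(1 / (numParams l L : ℝ)))) := by
  have : Nonempty (Fin K) := ⟨⟨0, hK⟩⟩
  have hV : Integrable (fun ω => ⨅ k : Fin K, ‖leadingParams (numParams l L) (T k ω) - θ₀‖) P :=
    .of_mem_Icc 0 (2 * c)
      (Measurable.iInf fun k : Fin K => ((continuous_leadingParams (numParams l L)).sub
        (continuous_const (y := θ₀))).norm.measurable.comp (hT k)).aemeasurable
      (.of_forall fun ω => iInf_mem_Icc fun k => norm_leadingParams_sub_mem_Icc (hTc k ω) hθ₀)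
  refine (integral_le_of_forall_le_add_sqrt (fun ω => integral_nonneg fun x => abs_nonneg _)
    hV hS (fun ω => (abs_nonneg _).trans (hdev _ (hϑc ω) ω)) hb hSb fun ω => ?_).trans
    (add_le_add_right (mul_le_mul_of_nonneg_left (integral_iInf_norm_leadingParams_sub_le
      (by linarith) hp0 hparams hθ₀ hT hTc hTindep hTident hTunif K)
      (netLipschitz_nonneg L l (by linarith))) _)
  obtain ⟨k, hk⟩ := exists_eq_ciInf_of_finite
    (f := fun k : Fin K => ‖leadingParams (numParams l L) (T k ω) - θ₀‖)
  rw [← hk]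
  exact integral_abs_clippedNN_sub_le hX hY hEm hE hL hlL hc hθ₀ happrox (hϑc ω) (hTc k ω)
    (fun θ hθ => hdev θ hθ ω) (hϑT ω k k.2)

end Training

theorem theorem1p1_general
    {d D L M K : ℕ} (hd : 1 ≤ d) (hL : 1 ≤ L) (hM : 1 ≤ M) (hK : 1 ≤ K)
    {c : ℝ} (hc : 2 ≤ c) {l : ℕ → ℕ} (hl : ∀ i ≤ L, 1 ≤ l i)
    (hl0 : l 0 = d) (hlL : l L = 1) (hparams : numParams l L ≤ D)
    {Ω : Type*} [MeasurableSpace Ω] {P : Measure Ω} [IsProbabilityMeasure P]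
    {X : ℕ → Ω → UnitCube d} {Y : ℕ → Ω → unitInterval}
    (hXYmeas : ∀ j, 1 ≤ j → Measurable (fun ω => (X j ω, Y j ω)))
    (hXYindep : iIndepFun (fun (j : ℕ) ω => (X (j + 1) ω, Y (j + 1) ω)) P)
    (hXYident : ∀ j, 1 ≤ j →
      IdentDistrib (fun ω => (X j ω, Y j ω)) (fun ω => (X 1 ω, Y 1 ω)) P P)
    {E : UnitCube d → unitInterval}
    (hE : (fun ω => (E (X 1 ω) : ℝ)) =ᵐ[P]
      P[fun ω => (Y 1 ω : ℝ) | MeasurableSpace.comap (X 1) inferInstance])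
    (hELip : ∀ x y : UnitCube d,
      |(E x : ℝ) - (E y : ℝ)| ≤ c * ∑ i, |(x : Fin d → ℝ) i - (y : Fin d → ℝ) i|)
    {T : ℕ → Ω → Fin D → ℝ} (hT : ∀ k, Measurable (T k))
    (hTrange : ∀ k ω, T k ω ∈ Set.Icc (fun _ => -c) (fun _ => c))
    (hTindep : iIndepFun T P) (hTident : ∀ k, IdentDistrib (T k) (T 0) P P)
    (hTunif : pdf.IsUniform (T 0) (Set.Icc (fun _ => -c) (fun _ => c)) P volume)
    {ϑ : Ω → Fin D → ℝ} (hϑ : Measurable ϑ) (hϑc : ∀ ω, ‖ϑ ω‖ ≤ c)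
    (hϑT : ∀ ω, ∀ k < K,
      empiricalRisk L l hl0 (fun j => X j ω) (fun j => Y j ω) M (ϑ ω)
        ≤ empiricalRisk L l hl0 (fun j => X j ω) (fun j => Y j ω) M (T k ω)) :
    Measurable (fun p : Ω × UnitCube d =>
      |clippedNN L l hl0 (ϑ p.1) (p.2 : Fin d → ℝ) - (E p.2 : ℝ)|) ∧
    ∫ ω, (∫ x : UnitCube d, |clippedNN L l hl0 (ϑ ω) (x : Fin d → ℝ) - (E x : ℝ)|
          ∂(P.map (X 1))) ∂P
      ≤ (d : ℝ) * c ^ 3 / (minSize L l : ℝ) ^ (1 / (d : ℝ))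
        + c ^ 3 * (L : ℝ) * ((maxWidth L l : ℝ) + 1) * Real.log (Real.exp 1 * (M : ℝ))
            / (M : ℝ) ^ (1 / 4 : ℝ)
        + (L : ℝ) * ((maxWidth L l : ℝ) + 1) ^ L * c ^ (L + 1)
            / (K : ℝ) ^ ((2 * (L : ℝ))⁻¹ * (((maxWidth L l : ℝ) + 1) ^ 2)⁻¹) := by
  have hEm := measurable_of_lipschitz_unitCube (by linarith) hELip
  refine ⟨measurable_abs_clippedNN_sub hϑ hEm, ?_⟩
  have hX : Measurable (X 1) := measurable_fst.comp (hXYmeas 1 le_rfl)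
  have hY : Measurable (Y 1) := measurable_snd.comp (hXYmeas 1 le_rfl)
  have : IsProbabilityMeasure (P.map (X 1)) := Measure.isProbabilityMeasure_map hX.aemeasurable
  have hnet := netLipschitz_mul_rpow_le (l := l) hL hc (numParams_ne_zero hL hlL) hK
  set a := (d : ℝ) * c ^ 3 / (minSize L l : ℝ) ^ (1 / (d : ℝ))
  set b := c ^ 3 * (L : ℝ) * ((maxWidth L l : ℝ) + 1) * Real.log (Real.exp 1 * (M : ℝ))
    / (M : ℝ) ^ (1 / 4 : ℝ)
  set t := (L : ℝ) * ((maxWidth L l : ℝ) + 1) ^ L * c ^ (L + 1)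
    / (K : ℝ) ^ ((2 * (L : ℝ))⁻¹ * (((maxWidth L l : ℝ) + 1) ^ 2)⁻¹)
  rcases le_or_gt 1 (a + b) with hab | hab
  · refine (integral_le_of_forall_mem_Icc (C := 1) fun ω =>
      ⟨integral_nonneg fun x => abs_nonneg _,
        integral_le_of_forall_mem_Icc (abs_clippedNN_sub_mem_Icc _)⟩).trans ?_
    have : 0 ≤ t := by positivity
    linarith
  · have hlog := log_exp_one_mul_pos hM
    have hb : 0 < b := by positivity
    have ha : 0 ≤ a := by positivity
    obtain ⟨θ₀, hθ₀, happrox⟩ :=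
      exists_clippedNN_approx hd hl0 hlL hc hELip (minSize_pos hL hl) (by linarith)
    obtain ⟨S, hS, hdev, hSb⟩ := exists_risk_deviation_bound_sq (hl0 := hl0) hL hlL hc
      (fun j => hXYmeas (j + 1) (by omega)) hXYindep (fun j => hXYident (j + 1) (by omega)) hM
      (by linarith)
    refine (integral_integral_abs_clippedNN_sub_le hX hY hEm hE hL hlL (by linarith) hθ₀ happrox
      hS (fun θ hθ => hdev θ hθ) hb hSb (numParams_ne_zero hL hlL) hparams hT
      (fun k ω => norm_le_of_mem_box (by linarith) (hTrange k ω)) hTindep hTident hTunif hϑc hK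
      hϑT).trans ?_
    linarith

/- Indices: `d`, `D` (length of the parameter vectors), `L` (depth), `J` (mini-batch size), `M`, `K`,
`N` are positive; `l 0, …, l L` are the layer dimensions (later values of `l` play no role);
`Lip` is the Lipschitz constant of the target `E`; `NN ⊆ {0, …, N}`; `kk` is the random index. -/
theorem theorem1p1
    (d D L J M K N : ℕ) (hd : 1 ≤ d) (hD : 1 ≤ D) (hL : 1 ≤ L) (hJ : 1 ≤ J)
    (hM : 1 ≤ M) (hK : 1 ≤ K) (hN : 1 ≤ N)
    (γ Lip c : ℝ) (hc : max 2 Lip ≤ c)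
    (l : ℕ → ℕ) (hl : ∀ i ≤ L, 1 ≤ l i)
    (NN : Finset ℕ) (hNN : ∀ n ∈ NN, n ≤ N) (hNN0 : 0 ∈ NN)
    (hl0 : l 0 = d) (hlL : l L = 1) (hparams : numParams l L ≤ D)
    {Ω : Type*} [MeasurableSpace Ω] (P : Measure Ω) [IsProbabilityMeasure P]
    -- the samples
    (X : ℕ → ℕ → ℕ → Ω → UnitCube d) (Y : ℕ → ℕ → ℕ → Ω → unitInterval)
    (hXYmeas : ∀ j, 1 ≤ j → Measurable (fun ω => (X 0 0 j ω, Y 0 0 j ω)))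
    (hXYindep : iIndepFun (fun (j : ℕ) ω => (X 0 0 (j + 1) ω, Y 0 0 (j + 1) ω)) P)
    (hXYident : ∀ j, 1 ≤ j → IdentDistrib (fun ω => (X 0 0 j ω, Y 0 0 j ω))
      (fun ω => (X 0 0 1 ω, Y 0 0 1 ω)) P P)
    -- the target function
    (E : UnitCube d → unitInterval)
    (hE : (fun ω => (E (X 0 0 1 ω) : ℝ)) =ᵐ[P]
      P[fun ω => (Y 0 0 1 ω : ℝ) | MeasurableSpace.comap (X 0 0 1) inferInstance])
    (hELip : ∀ x y : UnitCube d,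
      |(E x : ℝ) - (E y : ℝ)| ≤ Lip * ∑ i, |(x : Fin d → ℝ) i - (y : Fin d → ℝ) i|)
    -- the random parameter vectors, their initialisation and their training
    (Θ : ℕ → ℕ → Ω → (Fin D → ℝ)) (hΘmeas : ∀ k n, Measurable (Θ k n))
    (kk : Ω → ℕ × ℕ) (hkkmeas : Measurable kk)
    (hΘrange : ∀ k, 1 ≤ k → ∀ ω, Θ k 0 ω ∈ Set.Icc (fun _ => -c) (fun _ => c))
    (hΘindep : iIndepFun (fun (k : ℕ) => Θ (k + 1) 0) P)
    (hΘident : ∀ k, 1 ≤ k → IdentDistrib (Θ k 0) (Θ 1 0) P P)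
    (hΘunif : pdf.IsUniform (Θ 1 0) (Set.Icc (fun _ => -c) (fun _ => c)) P volume)
    (G : ℕ → ℕ → (Fin D → ℝ) → Ω → (Fin D → ℝ))
    (hG : ∀ k n, 1 ≤ k → 1 ≤ n → ∀ ω θ,
      DifferentiableAt ℝ
        (empiricalRisk L l hl0 (fun j => X k n j ω) (fun j => Y k n j ω) J) θ →
      G k n θ ω =
        grad (empiricalRisk L l hl0 (fun j => X k n j ω) (fun j => Y k n j ω) J) θ)
    (hΘstep : ∀ k n, 1 ≤ k → 1 ≤ n → ∀ ω,
      Θ k n ω = Θ k (n - 1) ω - γ • G k n (Θ k (n - 1) ω) ω)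
    -- `kk ω` is a minimiser over `{1, …, K} × NN` subject to `‖Θ_{l,m}(ω)‖_∞ ≤ c`
    (hkk : ∀ ω,
      ((kk ω).1 ∈ Finset.Icc 1 K ∧ (kk ω).2 ∈ NN ∧ ‖Θ (kk ω).1 (kk ω).2 ω‖ ≤ c) ∧
      ∀ q : ℕ × ℕ, q.1 ∈ Finset.Icc 1 K → q.2 ∈ NN → ‖Θ q.1 q.2 ω‖ ≤ c →
        empiricalRisk L l hl0 (fun j => X 0 0 j ω) (fun j => Y 0 0 j ω) M
            (Θ (kk ω).1 (kk ω).2 ω)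
          ≤ empiricalRisk L l hl0 (fun j => X 0 0 j ω) (fun j => Y 0 0 j ω) M
            (Θ q.1 q.2 ω)) :
    -- the left-hand side is well defined: its (bounded) integrand is jointly measurable
    Measurable (fun p : Ω × UnitCube d =>
      |clippedNN L l hl0 (Θ (kk p.1).1 (kk p.1).2 p.1) (p.2 : Fin d → ℝ) - (E p.2 : ℝ)|) ∧
    ∫ ω, (∫ x : UnitCube d,
        |clippedNN L l hl0 (Θ (kk ω).1 (kk ω).2 ω) (x : Fin d → ℝ) - (E x : ℝ)|
          ∂(P.map (X 0 0 1))) ∂P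
      ≤ (d : ℝ) * c ^ 3 / (minSize L l : ℝ) ^ (1 / (d : ℝ))
        + c ^ 3 * (L : ℝ) * ((maxWidth L l : ℝ) + 1) * Real.log (Real.exp 1 * (M : ℝ))
            / (M : ℝ) ^ (1 / 4 : ℝ)
        + (L : ℝ) * ((maxWidth L l : ℝ) + 1) ^ L * c ^ (L + 1)
            / (K : ℝ) ^ ((2 * (L : ℝ))⁻¹ * (((maxWidth L l : ℝ) + 1) ^ 2)⁻¹) := by
  have hc2 : 2 ≤ c := (le_max_left 2 Lip).trans hc
  have hELipc : ∀ x y : UnitCube d,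
      |(E x : ℝ) - (E y : ℝ)| ≤ c * ∑ i, |(x : Fin d → ℝ) i - (y : Fin d → ℝ) i| := fun x y =>
    (hELip x y).trans (mul_le_mul_of_nonneg_right ((le_max_right 2 Lip).trans hc)
      (Finset.sum_nonneg fun _ _ => abs_nonneg _))
  have hinit : ∀ k ω, Θ (k + 1) 0 ω ∈ Set.Icc (fun _ => -c) (fun _ => c) := fun k =>
    hΘrange (k + 1) (Nat.le_add_left 1 k)
  exact theorem1p1_general (X := X 0 0) (Y := Y 0 0) (T := fun k => Θ (k + 1) 0)
    (ϑ := fun ω => Θ (kk ω).1 (kk ω).2 ω) hd hL hM hK hc2 hl hl0 hlL hparams hXYmeas hXYindep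
    hXYident hE hELipc (fun k => hΘmeas (k + 1) 0) hinit hΘindep
    (fun k => hΘident (k + 1) (Nat.le_add_left 1 k)) hΘunif
    (measurable_random_index (Z := fun q : ℕ × ℕ => Θ q.1 q.2) (fun q => hΘmeas q.1 q.2) hkkmeas)
    (fun ω => (hkk ω).1.2.2)
    (fun ω k hk => (hkk ω).2 (k + 1, 0) (Finset.mem_Icc.2 ⟨Nat.le_add_left 1 k, hk⟩) hNN0
      (norm_le_of_mem_box (by linarith) (hinit k ω)))
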